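/- Let $X\subseteq\mathbb R^2$ be a feature space that contains the line $\mathbb R\times\{1\}$ (for instance $X=\mathbb R^2$, or $X=\mathbb R\times\{1\}$, which is the one-dimensional setting with bias). For $k\ge 1$ let $\mathcal H^{k,2}_{\mathrm{lin}}$ be the class of homogeneous linear score functions $x\mapsto Wx$, $W\in\mathbb R^{k\times 2}$; a score function $f$ labels $x$ by $\arg\max_{i\in[k]}f_i(x)$, ties being broken in favour of the smallest index. A pool-based active learner receives $\varepsilon$, $k$ and $m$ unlabelled i.i.d. points from an unknown probability distribution $D$ on $X$, adaptively queries an oracle for the unknown target $f^\star\in\mathcal H^{k,2}_{\mathrm{lin}}$ at points of the pool, and returns some $h:\mathbb R^2\to\mathbb R^k$. An argmax query at $x$ returns $\arg\max_i f^\star_i(x)$; a label-comparison query $(x,j_1,j_2)$ returns $\mathbf 1[f^\star_{j_1}(x)>f^\star_{j_2}(x)]$. The learner has query complexity $q(\varepsilon,k)$ if for some function $m_0(\varepsilon,k)$ and for all $D$, $k\ge1$, $f^\star$, $\varepsilon\in(0,1)$ and $m\ge m_0(\varepsilon,k)$ it never asks more than $q(\varepsilon,k)$ queries and, with probability at least $7/8$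 (over the sample and its internal randomness), $\Pr_{x\sim D}[\arg\max_i h_i(x)\ne\arg\max_i f^\star_i(x)]\le\varepsilon$. A tournament on $k$ labels is an adaptive procedure that finds the argmax of every score vector in $\mathbb R^k$ by pairwise comparisons of labels. An argmax learner is simulated through tournaments by answering each of its argmax queries at a point $x$ by a tournament on the $k$ labels at $x$, played with label-comparison queries. Then there are absolute constants $C,c>0$ and $a,b\in\mathbb N$ such that, for every such $X$: (1) there is a deterministic active learner with label-comparison queries whose query complexity satisfies $$q(\varepsilon,k)\le C\,k\log\tfrac1\varepsilon\,(\log k)^{a}\qquad\text{for all } k\ge 2,\ 0<\varepsilon\le\tfrac12,$$ that is, $q=\tilde O(k\log\frac1\varepsilon)$; (2) for every (possibly randomized) active learner with argmax queries that has a finite query complexity, and for every choice of tournaments on $k$ labels ($k\ge1$), every query complexity $q$, in label comparisons, of the simulated learner satisfies $$q(\varepsilon,k)\ge c\,\frac{k^2\log\frac1\varepsilon}{(\log k)^{b}}\qquad\text{for all } k\ge 2,\ 0<\varepsilon\le\tfrac12,$$ that is, $q=\tilde\Omega(k^2\log\frac1\varepsilon)$, even for the best argmax learner. -/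

import Mathlib

open MeasureTheory

noncomputable section

/-! ### Score functions, classification and loss -/

/-- The homogeneous linear class with `k` labels on `ℝ^d`: the score functions `x ↦ W x`. -/
def linearClass (d k : ℕ) : Set ((Fin d → ℝ) → Fin k → ℝ) :=
  Set.range fun (W : Matrix (Fin k) (Fin d) ℝ) (x : Fin d → ℝ) => W.mulVec x

/-- The labels of maximal score. -/
def maximizers {k : ℕ} (s : Fin k → ℝ) : Finset (Fin k) :=
  Finset.univ.filter fun i => ∀ j, s j ≤ s i

theorem maximizers_nonempty {k : ℕ} [NeZero k] (s : Fin k → ℝ) : (maximizers s).Nonempty := by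
  obtain ⟨i, -, hi⟩ := Finset.exists_max_image (Finset.univ : Finset (Fin k)) s ⟨0, Finset.mem_univ 0⟩
  exact ⟨i, by simpa [maximizers] using hi⟩

/-- The label of maximal score; ties are broken in favour of the smallest label. -/
def argmaxLabel {k : ℕ} [NeZero k] (s : Fin k → ℝ) : Fin k :=
  (maximizers s).min' (maximizers_nonempty s)

/-- The multiclass 0-1 loss of the hypothesis `h` against the target `f` under `D`. -/
def zeroOneLoss {d k : ℕ} [NeZero k] (D : Measure (Fin d → ℝ))
    (f h : (Fin d → ℝ) → Fin k → ℝ) : ENNReal :=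
  D {x | argmaxLabel (h x) ≠ argmaxLabel (f x)}

/-! ### Adaptive query procedures -/

/-- An adaptive procedure that asks queries in `Q`, receives answers in `R`, and finally returns
an element of `α`. -/
inductive QueryTree (Q R α : Type) : Type
  | output : α → QueryTree Q R α
  | ask : Q → (R → QueryTree Q R α) → QueryTree Q R α

namespace QueryTree

variable {Q R Q' R' α β : Type}

/-- The value returned when queries are answered by `o`. -/
def run (o : Q → R) : QueryTree Q R α → α
  | output a => a
  | ask q next => (next (o q)).run o

/-- The number of queries asked when queries are answered by `o`. -/
def cost (o : Q → R) : QueryTree Q R α → ℕ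
  | output _ => 0
  | ask q next => (next (o q)).cost o + 1

/-- Run a procedure, then continue with a procedure that depends on its result. -/
def bind : QueryTree Q R α → (α → QueryTree Q R β) → QueryTree Q R β
  | output a, g => g a
  | ask q next, g => ask q fun r => (next r).bind g

/-- Translate the queries of a procedure. -/
def mapQuery (g : Q → Q') : QueryTree Q R α → QueryTree Q' R α
  | output a => output a
  | ask q next => ask (g q) fun r => (next r).mapQuery g

/-- Replace each query `q` by the subprocedure `T q`, whose result is used as the answer. -/
def simulate (T : Q → QueryTree Q' R' R) : QueryTree Q R α → QueryTree Q' R' α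
  | output a => output a
  | ask q next => (T q).bind fun r => (next r).simulate T

end QueryTree

/-! ### Supervision -/

/-- A type of supervision for pool-based learning: for `k` labels and a pool of `m` points, the
queries that may be asked, their answers, and the correct answer for a given target function
and a given pool. -/
structure Supervision (d : ℕ) where
  Query : ℕ → ℕ → Type
  Answer : ℕ → Type
  oracle : ∀ (k m : ℕ) [NeZero k], ((Fin d → ℝ) → Fin k → ℝ) → (Fin m → Fin d → ℝ) →
    Query k m → Answer k

/-- Argmax queries: the query `i` asks for the label of the `i`-th pool point. -/
def argmaxSupervision (d : ℕ) : Supervision d where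
  Query _ m := Fin m
  Answer k := Fin k
  oracle _ _ _ f S := fun i => argmaxLabel (f (S i))

/-- Comparison queries for a fixed score vector: `(j₁, j₂)` asks whether `s j₂ < s j₁`. -/
def compareScores {k : ℕ} (s : Fin k → ℝ) (p : Fin k × Fin k) : Bool :=
  decide (s p.2 < s p.1)

/-- Label-comparison queries: `(i, j₁, j₂)` asks whether label `j₁` has a strictly larger score
than label `j₂` at the `i`-th pool point. -/
def comparisonSupervision (d : ℕ) : Supervision d where
  Query k m := Fin m × Fin k × Fin k
  Answer _ := Bool
  oracle _ _ _ f S := fun p => compareScores (f (S p.1)) p.2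

/-! ### Active learners and query complexity -/

/-- A pool-based active learner with internal random seed in `Ω`. It receives the accuracy, the
number of labels, the pool size, the unlabelled pool and the seed, and then queries the oracle
adaptively before it returns a hypothesis. -/
def ActiveLearner (d : ℕ) (O : Supervision d) (Ω : Type) : Type :=
  ∀ (_ε : ℝ) (k m : ℕ) [NeZero k], (Fin m → Fin d → ℝ) → Ω →
    QueryTree (O.Query k m) (O.Answer k) ((Fin d → ℝ) → Fin k → ℝ)

/-- The learner `A`, with seed distribution `ρ`, actively learns the classes `H k` on the feature
space `X` with query complexity `q`: for all sufficiently large pools it never asks more than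
`q ε k` queries, and with probability at least `7/8` over the i.i.d. pool and the seed it returns
a hypothesis of loss at most `ε`. (The failure probability is an outer measure, so that success
contains a measurable event of probability at least `7/8`.) -/
def LearnsWithQueries {d : ℕ} (X : Set (Fin d → ℝ)) (H : ∀ k, Set ((Fin d → ℝ) → Fin k → ℝ))
    (O : Supervision d) {Ω : Type} [MeasurableSpace Ω] (ρ : Measure Ω)
    (A : ActiveLearner d O Ω) (q : ℝ → ℕ → ℕ) : Prop :=
  ∃ mH : ℝ → ℕ → ℕ,
    ∀ (D : Measure (Fin d → ℝ)) [IsProbabilityMeasure D], (∀ᵐ x ∂D, x ∈ X) →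
    ∀ (k : ℕ) [NeZero k], ∀ f ∈ H k, ∀ ε : ℝ, 0 < ε → ε < 1 → ∀ m : ℕ, mH ε k ≤ m →
      (∀ (S : Fin m → Fin d → ℝ), (∀ i, S i ∈ X) → ∀ ω : Ω,
        (A ε k m S ω).cost (O.oracle k m f S) ≤ q ε k) ∧
      ((Measure.pi fun _ : Fin m => D).prod ρ)
        {p | ENNReal.ofReal ε <
          zeroOneLoss D f ((A ε k m p.1 p.2).run (O.oracle k m f p.1))} ≤ 1 / 8

/-! ### Simulation of argmax queries by comparison tournaments -/

/-- A tournament on `k` labels: an adaptive procedure that compares pairs of labels and correctly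
returns the label of maximal score, whatever the score vector is. -/
def IsTournament {k : ℕ} [NeZero k] (T : QueryTree (Fin k × Fin k) Bool (Fin k)) : Prop :=
  ∀ s : Fin k → ℝ, T.run (compareScores s) = argmaxLabel s

/-- The comparison learner that runs the argmax learner `A` and answers each argmax query at the
`i`-th pool point by playing the tournament `T k` with label comparisons at that point. -/
def simulateByTournaments {d : ℕ} {Ω : Type} (A : ActiveLearner d (argmaxSupervision d) Ω)
    (T : ∀ (k : ℕ) [NeZero k], QueryTree (Fin k × Fin k) Bool (Fin k)) :
    ActiveLearner d (comparisonSupervision d) Ω :=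
  fun ε k m _ S ω =>
    (A ε k m S ω).simulate fun i : Fin m => (T k).mapQuery fun p => (i, p)

end

/-! ### Argmax labels -/

/-! Lower bound. Every run of a tournament costs at least `k - 1` comparisons
(`IsTournament.le_cost`), because a label that has lost no comparison could still be the winner.
Hence `q` comparisons simulate at most `Q = q / (k - 1)` argmax queries. For a fixed pool and seed
these lead to at most `k ^ Q` outputs, while averaging over a finite family of targets gives a pool
and a seed that succeed on 7/8 of the family. If each output is `ε`-close to at most `B` targets,
the family has at most about `B * k ^ Q` members (`card_targets_le`). Two families on the line `x 1
= 1` are counted. In the first, about `k / 16` points choose their labels independently among 16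
private ones, so that even `ε = 1/2` forces `Q log k ≳ k`. In the second, `k - 1` thresholds have
about `1 / (ε k)` possible positions each, so that `Q log k ≳ k log (1/ε)` once `ε ≲ 1/k²`. For
larger `ε`, `log (1/ε)` is `O(log k)` and the first family suffices, at the price of one more
logarithm.

Upper bound. On each of the 9 sign classes of the plane, the comparison of two linear scores is
monotone or antitone in `x 0 / x 1` (`linear_sign_monotone`). So the points at which a given label
wins within a given set of labels form an interval of each class, and `2 ^ d` labels give at most `9
* 2 ^ d` intervals. The sample is labelled by divide and conquer over the labels: two halves are
merged by one binary search on each part of the common refinement, which has at most as many parts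
as the two partitions together (`card_image_refinement_le`). With `e` the logarithm of the sample
size, this costs `9 d 2 ^ d (e + 1)` comparisons at depth `d ≈ log k` (`cost_envelope_le`). A linear
hypothesis consistent with these labels errs only at points outside the span of the sample points of
their own cell (sign class and target label). A sample of size `O(k² / ε)` probably hits both `ε /
(18 k)`-tails of every cell that is not itself that small, which bounds the loss by `ε`. -/

theorem argmaxLabel_eq_iff {k : ℕ} [NeZero k] (s : Fin k → ℝ) (i : Fin k) :
    argmaxLabel s = i ↔ (∀ j, s j ≤ s i) ∧ ∀ j, j < i → s j < s i := by
  have hmem : ∀ j, j ∈ maximizers s ↔ ∀ l, s l ≤ s j := by simp [maximizers]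
  constructor
  · rintro rfl
    have h1 : ∀ l, s l ≤ s (argmaxLabel s) :=
      (hmem _).1 (Finset.min'_mem _ (maximizers_nonempty s))
    refine ⟨h1, fun j hj => ?_⟩
    by_contra h
    exact absurd hj (not_lt.2 (Finset.min'_le _ _
      ((hmem j).2 fun l => (h1 l).trans (not_lt.1 h))))
  · rintro ⟨h1, h2⟩
    refine le_antisymm (Finset.min'_le _ _ ((hmem i).2 h1)) (Finset.le_min' _ _ _ fun j hj => ?_)
    by_contra h
    exact absurd ((hmem j).1 hj i) (not_le.2 (h2 j (not_le.1 h)))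

theorem argmaxLabel_eq_of_forall_lt {k : ℕ} [NeZero k] (s : Fin k → ℝ) (i : Fin k)
    (h : ∀ j, j ≠ i → s j < s i) : argmaxLabel s = i := by
  refine (argmaxLabel_eq_iff s i).2 ⟨fun j => ?_, fun j hj => h j hj.ne⟩
  rcases eq_or_ne j i with rfl | hj
  · exact le_rfl
  · exact (h j hj).le

/-! ### Query trees -/

namespace QueryTree

variable {Q R Q' R' α β : Type}

theorem run_bind (o : Q → R) (t : QueryTree Q R α) (g : α → QueryTree Q R β) :
    (t.bind g).run o = (g (t.run o)).run o := by
  induction t with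
  | output a => rfl
  | ask q next ih => exact ih (o q)

theorem cost_bind (o : Q → R) (t : QueryTree Q R α) (g : α → QueryTree Q R β) :
    (t.bind g).cost o = t.cost o + (g (t.run o)).cost o := by
  induction t with
  | output a => simp [bind, cost, run]
  | ask q next ih => simp only [bind, cost, run, ih]; omega

theorem run_mapQuery (g : Q → Q') (o : Q' → R) (t : QueryTree Q R α) :
    (t.mapQuery g).run o = t.run fun q => o (g q) := by
  induction t with
  | output a => rfl
  | ask q next ih => exact ih (o (g q))

theorem cost_mapQuery (g : Q → Q') (o : Q' → R) (t : QueryTree Q R α) :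
    (t.mapQuery g).cost o = t.cost fun q => o (g q) := by
  induction t with
  | output a => rfl
  | ask q next ih => simp only [mapQuery, cost, ih]

theorem mul_cost_le_cost_simulate (T : Q → QueryTree Q' R' R) (o : Q' → R') (o' : Q → R) (c : ℕ)
    (ho : ∀ q, (T q).run o = o' q) (hc : ∀ q, c ≤ (T q).cost o) (t : QueryTree Q R α) :
    c * t.cost o' ≤ (t.simulate T).cost o := by
  induction t with
  | output a => simp [cost]
  | ask q next ih =>
    simp only [simulate, cost, cost_bind, mul_add, mul_one, ho]
    have h1 := ih (o' q)
    have h2 := hc q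
    omega

/-- A procedure that asks at most `n` queries has at most `|R| ^ n` different outcomes. -/
theorem card_image_run_le [Fintype R] [Nonempty R] [DecidableEq R] [DecidableEq α] {ι : Type}
    (t : QueryTree Q R α) (o : ι → Q → R) (n : ℕ) (s : Finset ι)
    (h : ∀ i ∈ s, t.cost (o i) ≤ n) :
    (s.image fun i => t.run (o i)).card ≤ Fintype.card R ^ n := by
  classical
  induction t generalizing n s with
  | output a =>
    calc (s.image fun _ => a).card ≤ ({a} : Finset α).card :=
          Finset.card_le_card (by intro x; simp only [Finset.mem_image, Finset.mem_singleton]; grind)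
      _ ≤ _ := Nat.one_le_pow _ _ Fintype.card_pos
  | ask q next ih =>
    rcases s.eq_empty_or_nonempty with rfl | ⟨i₀, hi₀⟩
    · simp
    obtain ⟨n, rfl⟩ : ∃ n', n = n' + 1 :=
      Nat.exists_eq_succ_of_ne_zero (by have := h i₀ hi₀; simp only [cost] at this; omega)
    calc (s.image fun i => (ask q next).run (o i)).card
        ≤ (Finset.univ.biUnion fun r : R =>
            (s.filter fun i => o i q = r).image fun i => (next r).run (o i)).card := by
          refine Finset.card_le_card fun x hx => ?_
          obtain ⟨i, hi, rfl⟩ := Finset.mem_image.1 hx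
          exact Finset.mem_biUnion.2 ⟨o i q, Finset.mem_univ _,
            Finset.mem_image.2 ⟨i, by simp [hi], rfl⟩⟩
      _ ≤ ∑ _r : R, Fintype.card R ^ n := by
          refine Finset.card_biUnion_le.trans (Finset.sum_le_sum fun r _ => ih r n _ fun i hi => ?_)
          obtain ⟨his, rfl⟩ := Finset.mem_filter.1 hi
          have := h i his
          simp only [cost] at this
          omega
      _ = Fintype.card R ^ (n + 1) := by simp [pow_succ, mul_comm]

/-- The labels that lose some comparison. -/
def losers {k : ℕ} (o : Fin k × Fin k → Bool) :
    QueryTree (Fin k × Fin k) Bool α → Finset (Fin k)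
  | output _ => ∅
  | ask p next => insert (if o p then p.2 else p.1) ((next (o p)).losers o)

theorem card_losers_le_cost {k : ℕ} (o : Fin k × Fin k → Bool)
    (t : QueryTree (Fin k × Fin k) Bool α) : (t.losers o).card ≤ t.cost o := by
  induction t with
  | output a => simp [losers]
  | ask p next ih => exact (Finset.card_insert_le _ _).trans (Nat.succ_le_succ (ih (o p)))

/-- Raising a label that won every comparison in which it took part only confirms the answers
already given, so the run cannot notice the change. -/
theorem run_update_of_notMem_losers {k : ℕ} (s : Fin k → ℝ) (j : Fin k) (M : ℝ) (hM : s j ≤ M)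
    (t : QueryTree (Fin k × Fin k) Bool α) (hj : j ∉ t.losers (compareScores s)) :
    t.run (compareScores (Function.update s j M)) = t.run (compareScores s) := by
  induction t with
  | output a => rfl
  | ask p next ih =>
    simp only [losers, Finset.mem_insert, not_or] at hj
    have key : compareScores (Function.update s j M) p = compareScores s p := by
      have hle : ∀ i, s i ≤ Function.update s j M i := by
        intro i
        rcases eq_or_ne i j with rfl | hi
        · simpa using hM
        · simp [hi]
      have h1 := hj.1
      unfold compareScores at h1 ⊢
      by_cases hp : s p.2 < s p.1
      · simp only [hp, decide_true, if_true] at h1 ⊢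
        rw [decide_eq_true_iff, Function.update_of_ne (Ne.symm h1)]
        exact hp.trans_le (hle _)
      · simp only [hp, decide_false, Bool.false_eq_true, if_false] at h1 ⊢
        rw [decide_eq_false_iff_not, Function.update_of_ne (Ne.symm h1)]
        exact not_lt.2 ((not_lt.1 hp).trans (hle _))
    simp only [run, key]
    exact ih _ hj.2

end QueryTree

/-- Every run of a tournament makes at least `k - 1` comparisons. -/
theorem IsTournament.le_cost {k : ℕ} [NeZero k] {T : QueryTree (Fin k × Fin k) Bool (Fin k)}
    (hT : IsTournament T) (s : Fin k → ℝ) : k - 1 ≤ T.cost (compareScores s) := by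
  have hsub : Finset.univ.erase (argmaxLabel s) ⊆ T.losers (compareScores s) := by
    intro j hj
    -- A label that never lost could be raised above the winner, and the tournament would still
    -- return the old winner.
    by_contra hl
    have hmax := ((argmaxLabel_eq_iff s _).1 rfl).1
    have hrun := QueryTree.run_update_of_notMem_losers s j (s (argmaxLabel s) + 1)
      ((hmax j).trans (by linarith)) T hl
    rw [hT, hT, argmaxLabel_eq_of_forall_lt _ j fun i hi => ?_] at hrun
    · exact (Finset.mem_erase.1 hj).1 hrun
    · simp only [Function.update_of_ne hi, Function.update_self]
      linarith [hmax i]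
  calc k - 1 = (Finset.univ.erase (argmaxLabel s)).card := by simp
    _ ≤ _ := (Finset.card_le_card hsub).trans (T.card_losers_le_cost _)

theorem mul_cost_le_cost_simulateByTournaments {d : ℕ} {Ω : Type}
    (A : ActiveLearner d (argmaxSupervision d) Ω)
    (T : ∀ (k : ℕ) [NeZero k], QueryTree (Fin k × Fin k) Bool (Fin k))
    (hT : ∀ (k : ℕ) [NeZero k], IsTournament (T k)) (ε : ℝ) (k m : ℕ) [NeZero k]
    (f : (Fin d → ℝ) → Fin k → ℝ) (S : Fin m → Fin d → ℝ) (ω : Ω) :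
    (k - 1) * (A ε k m S ω).cost ((argmaxSupervision d).oracle k m f S) ≤
      (simulateByTournaments A T ε k m S ω).cost ((comparisonSupervision d).oracle k m f S) := by
  exact QueryTree.mul_cost_le_cost_simulate
    (fun i : Fin m => (T k).mapQuery fun p => (i, p))
    ((comparisonSupervision d).oracle k m f S) ((argmaxSupervision d).oracle k m f S) (k - 1)
    (fun i => (QueryTree.run_mapQuery _ _ _).trans (hT k (f (S i))))
    (fun i => ((hT k).le_cost (f (S i))).trans_eq
      (QueryTree.cost_mapQuery (fun p => (i, p))
        ((comparisonSupervision d).oracle k m f S) (T k)).symm)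
    (A ε k m S ω)

/-! ### Counting targets -/

/-- The expected number of failing targets is at most `|F| / 8`, so some outcome outside the null
set does not exceed this mean. Failure events need not be measurable, hence the measurable hulls.
`N` will be the event that the pool leaves `X`, where no cost bound is available. -/
theorem exists_notMem_card_le_of_measure_le {β F : Type*} [MeasurableSpace β] [Fintype F]
    (μ : Measure β) [IsProbabilityMeasure μ] (E : F → Set β) (hE : ∀ t, μ (E t) ≤ 1 / 8)
    (N : Set β) (hN : μ N = 0) :
    ∃ p, p ∉ N ∧ 8 * {t | p ∈ E t}.ncard ≤ Fintype.card F := by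
  classical
  set φ : β → ENNReal := fun p => ∑ t, (toMeasurable μ (E t)).indicator 1 p with hφ
  have hmeas : ∀ t, Measurable ((toMeasurable μ (E t)).indicator (1 : β → ENNReal)) :=
    fun t => measurable_one.indicator (measurableSet_toMeasurable _ _)
  have hint : ∫⁻ p, φ p ∂μ ≤ Fintype.card F * (1 / 8) := by
    rw [hφ, lintegral_finsetSum _ fun t _ => hmeas t]
    calc _ ≤ ∑ _t : F, (1 / 8 : ENNReal) := Finset.sum_le_sum fun t _ => by
            rw [lintegral_indicator_one (measurableSet_toMeasurable _ _), measure_toMeasurable]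
            exact hE t
      _ = _ := by simp
  obtain ⟨p, hp, hle⟩ := exists_notMem_null_le_lintegral
    (Finset.measurable_sum _ fun t _ => hmeas t).aemeasurable hN (μ := μ) (f := φ)
  refine ⟨p, hp, ?_⟩
  have hcard : ({t | p ∈ E t}.ncard : ENNReal) ≤ φ p := by
    rw [Set.ncard_eq_toFinset_card', hφ, Finset.card_eq_sum_ones, Nat.cast_sum]
    refine (Finset.sum_le_sum fun t ht => ?_).trans
      (Finset.sum_le_sum_of_subset (Finset.subset_univ _))
    have : p ∈ toMeasurable μ (E t) := subset_toMeasurable _ _ (by simpa using ht)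
    simp [this]
  have h := (hcard.trans hle).trans hint
  have h8 : (8 : ENNReal) * ({t | p ∈ E t}.ncard : ENNReal) ≤ Fintype.card F := by
    calc _ ≤ (8 : ENNReal) * (Fintype.card F * (1 / 8)) := by gcongr
      _ = Fintype.card F * (8 * 8⁻¹) := by rw [one_div]; ring
      _ = _ := by rw [ENNReal.mul_inv_cancel (by norm_num) (by norm_num), mul_one]
  exact_mod_cast h8

/-- The uniform distribution on a finite family of points. -/
noncomputable def uniformPoints {I β : Type*} [Fintype I] [MeasurableSpace β] (x : I → β) :
    Measure β :=
  (Fintype.card I : ENNReal)⁻¹ • ∑ i, Measure.dirac (x i)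

theorem uniformPoints_apply {I β : Type*} [Fintype I] [MeasurableSpace β]
    [MeasurableSingletonClass β] (x : I → β) (s : Set β) :
    uniformPoints x s = (Fintype.card I : ENNReal)⁻¹ * {i | x i ∈ s}.ncard := by
  classical
  rw [uniformPoints, Measure.smul_apply, Measure.finsetSum_apply, smul_eq_mul]
  simp only [Measure.dirac_apply, Set.indicator_apply, Pi.one_apply, Finset.sum_boole]
  rw [Set.ncard_eq_toFinset_card']
  simp

instance {I β : Type*} [Fintype I] [Nonempty I] [MeasurableSpace β]
    [MeasurableSingletonClass β] (x : I → β) : IsProbabilityMeasure (uniformPoints x) where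
  measure_univ := by
    rw [uniformPoints_apply]
    simp only [Set.mem_univ, Set.ofPred_true, Set.ncard_univ, Nat.card_eq_fintype_card]
    exact ENNReal.inv_mul_cancel (by simp) (by simp)

theorem zeroOneLoss_uniformPoints_le_iff {I : Type} [Fintype I] [Nonempty I] {d k : ℕ} [NeZero k]
    (x : I → Fin d → ℝ) (f h : (Fin d → ℝ) → Fin k → ℝ) (ε : ℝ) (hε : 0 ≤ ε) :
    zeroOneLoss (uniformPoints x) f h ≤ ENNReal.ofReal ε ↔
      ({i | argmaxLabel (h (x i)) ≠ argmaxLabel (f (x i))}.ncard : ℝ) ≤ ε * Fintype.card I := by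
  rw [zeroOneLoss, uniformPoints_apply, mul_comm, ← div_eq_mul_inv,
    ENNReal.div_le_iff (by simp) (by simp), ← ENNReal.ofReal_natCast, ← ENNReal.ofReal_natCast,
    ← ENNReal.ofReal_mul hε, ENNReal.ofReal_le_ofReal_iff (by positivity)]
  rfl

/-- If every labelling of the points is `ε`-close to at most `B` of the targets, then a learner
that asks at most `n` argmax queries can only succeed on few targets. -/
theorem card_targets_le {X : Set (Fin 2 → ℝ)} {Ω : Type} [MeasurableSpace Ω] {ρ : Measure Ω}
    [IsProbabilityMeasure ρ] {A : ActiveLearner 2 (argmaxSupervision 2) Ω} {qArg : ℝ → ℕ → ℕ}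
    (hA : LearnsWithQueries X (linearClass 2) (argmaxSupervision 2) ρ A qArg)
    {T : ∀ (k : ℕ) [NeZero k], QueryTree (Fin k × Fin k) Bool (Fin k)}
    (hT : ∀ (k : ℕ) [NeZero k], IsTournament (T k)) {q : ℝ → ℕ → ℕ}
    (hq : LearnsWithQueries X (linearClass 2) (comparisonSupervision 2) ρ
      (simulateByTournaments A T) q)
    {k : ℕ} [NeZero k] {ε : ℝ} (hk : 2 ≤ k) (hε : 0 < ε) (hε1 : ε < 1)
    {I F : Type} [Fintype I] [Nonempty I] [Fintype F] (x : I → Fin 2 → ℝ) (hx : ∀ i, x i ∈ X)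
    (f : F → (Fin 2 → ℝ) → Fin k → ℝ) (hf : ∀ t, f t ∈ linearClass 2 k) (B : ℕ)
    (hB : ∀ g : I → Fin k,
      {t | ({i | g i ≠ argmaxLabel (f t (x i))}.ncard : ℝ) ≤ ε * Fintype.card I}.ncard ≤ B) :
    7 * Fintype.card F ≤ 8 * (B * k ^ (q ε k / (k - 1))) := by
  classical
  obtain ⟨m₁, h₁⟩ := hA
  obtain ⟨m₂, h₂⟩ := hq
  set D := uniformPoints x with hD
  have hDX : ∀ᵐ y ∂D, y ∈ X := by
    rw [ae_iff, hD, uniformPoints_apply]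
    simp [hx]
  set m := max (m₁ ε k) (m₂ ε k) with hm
  set μ := (Measure.pi fun _ : Fin m => D).prod ρ with hμ
  set E : F → Set ((Fin m → Fin 2 → ℝ) × Ω) := fun t =>
    {p | ENNReal.ofReal ε < zeroOneLoss D (f t)
      ((A ε k m p.1 p.2).run ((argmaxSupervision 2).oracle k m (f t) p.1))} with hE
  have hN : μ {p | ¬ ∀ i, p.1 i ∈ X} = 0 := by
    have : ∀ᵐ S ∂(Measure.pi fun _ : Fin m => D), ∀ i, S i ∈ X :=
      ae_all_iff.2 fun i => (Measure.quasiMeasurePreserving_eval _ i).ae hDX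
    exact ae_iff.1 (Measure.quasiMeasurePreserving_fst.ae this)
  -- From here on the pool and the seed are fixed: one query tree succeeds on at least 7/8 of the
  -- targets.
  obtain ⟨⟨S, ω⟩, hpX, hp⟩ := exists_notMem_card_le_of_measure_le μ E
    (fun t => (h₁ D hDX k (f t) (hf t) ε hε hε1 m (le_max_left _ _)).2) _ hN
  simp only [Set.mem_ofPred_eq, not_not] at hpX
  set out : F → (Fin 2 → ℝ) → Fin k → ℝ := fun t =>
    (A ε k m S ω).run ((argmaxSupervision 2).oracle k m (f t) S) with hout
  have hcost : ∀ t ∈ (Finset.univ : Finset F),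
      (A ε k m S ω).cost ((argmaxSupervision 2).oracle k m (f t) S) ≤ q ε k / (k - 1) := by
    intro t _
    rw [Nat.le_div_iff_mul_le (by omega), mul_comm]
    exact (mul_cost_le_cost_simulateByTournaments A T hT ε k m (f t) S ω).trans
      ((h₂ D hDX k (f t) (hf t) ε hε hε1 m (le_max_right _ _)).1 S hpX ω)
  have himg : (Finset.univ.image out).card ≤ k ^ (q ε k / (k - 1)) := by
    have := QueryTree.card_image_run_le (R := Fin k) (A ε k m S ω)
      (fun t => (argmaxSupervision 2).oracle k m (f t) S) _ Finset.univ hcost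
    rwa [Fintype.card_fin] at this
  have hgood : (Finset.univ.filter fun t => (S, ω) ∉ E t).card ≤
      B * (Finset.univ.image out).card := by
    refine Finset.card_le_mul_card_image_of_maps_to (f := out) (fun t _ => by simp) B
      fun h _ => ?_
    refine le_trans ?_ (hB fun i => argmaxLabel (h (x i)))
    rw [Set.ncard_eq_toFinset_card']
    refine Finset.card_le_card fun t ht => ?_
    obtain ⟨hgood, rfl⟩ := Finset.mem_filter.1 ht
    have hloss : (S, ω) ∉ E t := (Finset.mem_filter.1 hgood).2
    simpa using (zeroOneLoss_uniformPoints_le_iff x (f t) _ ε hε.le).1 (not_lt.1 hloss)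
  have hsplit : {t | (S, ω) ∈ E t}.ncard + (Finset.univ.filter fun t => (S, ω) ∉ E t).card =
      Fintype.card F := by
    rw [Set.ncard_eq_toFinset_card', ← Finset.card_univ,
      ← Finset.card_filter_add_card_filter_not (s := Finset.univ) (fun t => (S, ω) ∈ E t)]
    simp
  have := Nat.mul_le_mul_left B himg
  omega

/-! ### Families of targets on a line -/

/-- The score function whose `i`-th score at `(y, 1)` is `a i * y + b i`. -/
def lineScore {k : ℕ} (a b : Fin k → ℝ) (x : Fin 2 → ℝ) (i : Fin k) : ℝ :=
  a i * x 0 + b i * x 1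

theorem lineScore_mem_linearClass {k : ℕ} (a b : Fin k → ℝ) : lineScore a b ∈ linearClass 2 k :=
  ⟨Matrix.of fun i => ![a i, b i], by
    ext x i
    simp [lineScore, Matrix.mulVec, dotProduct, Fin.sum_univ_two]⟩

/-! #### Independent labels at `M` points -/

/-- Label number `j` of group `p`, when the labels come in `M` groups of size `g`. -/
def groupLabel {k g M : ℕ} (h : M * g ≤ k) (p : Fin M) (j : Fin g) : Fin k :=
  ⟨p * g + j, by
    have h1 : ((p : ℕ) + 1) * g ≤ M * g := Nat.mul_le_mul_right _ p.2
    have h2 := j.2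
    rw [add_mul] at h1
    omega⟩

theorem groupLabel_div {k g M : ℕ} (h : M * g ≤ k) (p : Fin M) (j : Fin g) :
    (groupLabel h p j : ℕ) / g = p := by
  have := j.2
  change ((p : ℕ) * g + j) / g = p
  rw [mul_comm, Nat.mul_add_div (by omega), Nat.div_eq_of_lt this, add_zero]

theorem groupLabel_injective {k g M : ℕ} (h : M * g ≤ k) (p : Fin M) :
    Function.Injective (groupLabel h p) := by
  intro i j hij
  have := congrArg Fin.val hij
  simp only [groupLabel] at this
  exact Fin.ext (by omega)

open Classical in
/-- At the point `(p, 1)` the winner is label `t p` of group `p`: the scores are tangents of a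
parabola. -/
noncomputable def tangentTarget {k g M : ℕ} (h : M * g ≤ k) (t : Fin M → Fin g) :
    (Fin 2 → ℝ) → Fin k → ℝ :=
  lineScore
    (fun l => if ∃ p, l = groupLabel h p (t p) then 2 * ((l : ℕ) / g : ℕ) else 0)
    (fun l => if ∃ p, l = groupLabel h p (t p) then -(((l : ℕ) / g : ℕ) : ℝ) ^ 2 else -1)

theorem argmaxLabel_tangentTarget {k g M : ℕ} [NeZero k] (h : M * g ≤ k) (t : Fin M → Fin g)
    (p : Fin M) :
    argmaxLabel (tangentTarget h t ![(p : ℕ), 1]) = groupLabel h p (t p) := by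
  -- At `p` the tangent chosen by group `p'` has the value `p² - (p - p')²`, and every label that is
  -- not chosen has the value `-1`.
  refine argmaxLabel_eq_of_forall_lt _ _ fun l hl => ?_
  have hp : tangentTarget h t ![(p : ℕ), 1] (groupLabel h p (t p)) = (p : ℝ) ^ 2 := by
    simp only [tangentTarget, lineScore]
    rw [if_pos ⟨p, rfl⟩, if_pos ⟨p, rfl⟩, groupLabel_div]
    simp
    ring
  rw [hp]
  by_cases hex : ∃ p', l = groupLabel h p' (t p')
  · obtain ⟨p', rfl⟩ := hex
    have hne : p' ≠ p := by rintro rfl; exact hl rfl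
    have hne' : ((p' : ℕ) : ℝ) - (p : ℕ) ≠ 0 :=
      sub_ne_zero.2 fun e => hne (Fin.ext (Nat.cast_injective e))
    simp only [tangentTarget, lineScore]
    rw [if_pos ⟨p', rfl⟩, if_pos ⟨p', rfl⟩, groupLabel_div]
    simp
    nlinarith [pow_pos (abs_pos.2 hne') 2, sq_abs (((p' : ℕ) : ℝ) - (p : ℕ))]
  · simp only [tangentTarget, lineScore]
    rw [if_neg hex, if_neg hex]
    simp
    nlinarith [sq_nonneg ((p : ℕ) : ℝ)]

/-- A generating function for the number of agreements: the weight `c + 1` per agreement factorizes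
over the positions, and each factor is at most `g + c` since by injectivity at most one choice
agrees there. -/
theorem sum_pow_agree_le {M g c : ℕ} {κ : Type*} [DecidableEq κ] (lab : Fin M → Fin g → κ)
    (hlab : ∀ p, Function.Injective (lab p)) (h : Fin M → κ) :
    ∑ t : Fin M → Fin g, (c + 1) ^ (Finset.univ.filter fun p => h p = lab p (t p)).card ≤
      (g + c) ^ M := by
  have hprod : ∀ t : Fin M → Fin g,
      (c + 1) ^ (Finset.univ.filter fun p => h p = lab p (t p)).card =
        ∏ p, (1 + if h p = lab p (t p) then c else 0) := by
    intro t
    rw [← Finset.prod_const, Finset.prod_filter]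
    refine Finset.prod_congr rfl fun p _ => ?_
    split_ifs <;> ring
  simp only [hprod]
  have := Finset.prod_univ_sum (fun _ : Fin M => (Finset.univ : Finset (Fin g)))
    (fun p j => 1 + if h p = lab p j then c else 0)
  rw [Fintype.piFinset_univ] at this
  rw [← this]
  calc _ ≤ ∏ _p : Fin M, (g + c) := Finset.prod_le_prod' fun p _ => ?_
    _ = _ := by simp
  rw [Finset.sum_add_distrib, ← Finset.sum_filter, Finset.sum_const, Finset.sum_const,
    Finset.card_univ, Fintype.card_fin, smul_eq_mul, mul_one, smul_eq_mul]
  refine Nat.add_le_add_left ((Nat.mul_le_mul_right c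
    (Finset.card_le_one.2 fun i hi j hj => hlab p ?_)).trans_eq (one_mul c)) g
  rw [← (Finset.mem_filter.1 hi).2, ← (Finset.mem_filter.1 hj).2]

/-- At most half of the positions disagree for few choices only. -/
theorem ncard_half_agree_mul_le {M g c : ℕ} {κ : Type*} (lab : Fin M → Fin g → κ)
    (hlab : ∀ p, Function.Injective (lab p)) (h : Fin M → κ) {ε : ℝ} (hε : ε ≤ 1 / 2) :
    {t : Fin M → Fin g | ({p | h p ≠ lab p (t p)}.ncard : ℝ) ≤ ε * Fintype.card (Fin M)}.ncard *
      (c + 1) ^ ((M + 1) / 2) ≤ (g + c) ^ M := by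
  classical
  refine le_trans ?_ (sum_pow_agree_le (c := c) lab hlab h)
  rw [Set.ncard_eq_toFinset_card', ← smul_eq_mul, ← Finset.sum_const]
  -- Markov's inequality for the weights: a choice with at most half disagreements has at least `⌈M
  -- / 2⌉` agreements.
  refine (Finset.sum_le_sum fun t ht => ?_).trans
    (Finset.sum_le_sum_of_subset (Finset.subset_univ _))
  refine Nat.pow_le_pow_right (Nat.succ_pos c) ?_
  have ht' : ({p | h p ≠ lab p (t p)}.ncard : ℝ) ≤ ε * Fintype.card (Fin M) := by simpa using ht
  rw [Set.ncard_eq_toFinset_card', Fintype.card_fin] at ht'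
  have hsum := Finset.card_filter_add_card_filter_not (s := Finset.univ)
    (fun p => h p = lab p (t p))
  rw [Finset.card_univ, Fintype.card_fin] at hsum
  have hset : ({p | h p ≠ lab p (t p)} : Set (Fin M)).toFinset =
      Finset.univ.filter fun p => ¬ h p = lab p (t p) := by ext; simp
  rw [hset] at ht'
  have hhalf : (2 * (Finset.univ.filter fun p => ¬ h p = lab p (t p)).card : ℝ) ≤ M := by
    nlinarith [Nat.cast_nonneg (α := ℝ) M]
  have : 2 * (Finset.univ.filter fun p => ¬ h p = lab p (t p)).card ≤ M := by exact_mod_cast hhalf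
  omega

/-! #### Independent thresholds -/

theorem argmaxLabel_of_increments {k : ℕ} [NeZero k] (s : Fin k → ℝ) (d : ℕ → ℝ)
    (hs : ∀ i : Fin k, s i = ∑ l ∈ Finset.range i, d l) (j : Fin k)
    (hpos : ∀ l : ℕ, l < j → 0 < d l) (hneg : ∀ l, (j : ℕ) ≤ l → l + 1 < k → d l < 0) :
    argmaxLabel s = j := by
  refine argmaxLabel_eq_of_forall_lt _ _ fun i hi => ?_
  rw [hs, hs]
  rcases lt_or_gt_of_ne hi with hlt | hgt
  · have h := Finset.sum_Ico_eq_sub d (le_of_lt (Fin.lt_def.1 hlt))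
    have : 0 < ∑ l ∈ Finset.Ico (i : ℕ) j, d l :=
      Finset.sum_pos (fun l hl => hpos l (Finset.mem_Ico.1 hl).2)
        ⟨i, Finset.mem_Ico.2 ⟨le_rfl, hlt⟩⟩
    linarith
  · have h := Finset.sum_Ico_eq_sub d (le_of_lt (Fin.lt_def.1 hgt))
    have : ∑ l ∈ Finset.Ico (j : ℕ) i, d l < 0 :=
      Finset.sum_neg (fun l hl => by
        have := Finset.mem_Ico.1 hl
        exact hneg l this.1 (by omega)) ⟨j, Finset.mem_Ico.2 ⟨le_rfl, hgt⟩⟩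
    linarith

/-- The threshold between the labels `l` and `l + 1`. -/
noncomputable def thresholdAt {n N : ℕ} (t : Fin n → Fin N) (l : ℕ) : ℝ :=
  if h : l < n then 2 * (l * N + t ⟨l, h⟩) else 0

/-- The labels appear in increasing order, separated by the thresholds `thresholdAt t`. -/
noncomputable def thresholdTarget {n N : ℕ} (t : Fin n → Fin N) :
    (Fin 2 → ℝ) → Fin (n + 1) → ℝ :=
  lineScore (fun i => (i : ℕ)) (fun i => -∑ l ∈ Finset.range i, thresholdAt t l)

/-- Threshold `l` is an even integer in its own window `[2lN, 2(l+1)N)`, so the thresholds increase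
with `l`. The test points are odd, so no ties occur, and a test point in window `c` is separated
from all thresholds but the `c`-th by the windows alone. -/
theorem argmaxLabel_thresholdTarget {n N : ℕ} (t : Fin n → Fin N) (c : Fin n) (u : Fin N) :
    argmaxLabel (thresholdTarget t ![2 * ((c : ℕ) * N + (u : ℕ)) + 1, 1]) =
      if t c ≤ u then c.succ else c.castSucc := by
  have hbefore : ∀ l : ℕ, l < c →
      0 < (2 * (((c : ℕ) : ℝ) * N + (u : ℕ)) + 1) - thresholdAt t l := by
    intro l hl
    have hln : l < n := hl.trans c.2
    have h1 : (l + 1) * N ≤ (c : ℕ) * N := Nat.mul_le_mul_right _ hl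
    have h2 := (t ⟨l, hln⟩).2
    have h3 : l * N + (t ⟨l, hln⟩ : ℕ) ≤ c * N + u := by rw [add_mul] at h1; omega
    have h4 : ((l : ℝ) * N + (t ⟨l, hln⟩ : ℕ)) ≤ (c : ℕ) * N + (u : ℕ) := by exact_mod_cast h3
    rw [thresholdAt, dif_pos hln]
    linarith
  have hafter : ∀ l : ℕ, (c : ℕ) < l → l < n →
      (2 * (((c : ℕ) : ℝ) * N + (u : ℕ)) + 1) - thresholdAt t l < 0 := by
    intro l hl hln
    have h1 : ((c : ℕ) + 1) * N ≤ l * N := Nat.mul_le_mul_right _ hl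
    have h2 := u.2
    have h3 : (c : ℕ) * N + u + 1 ≤ l * N + (t ⟨l, hln⟩ : ℕ) := by rw [add_mul] at h1; omega
    have h4 : (((c : ℕ) : ℝ) * N + (u : ℕ)) + 1 ≤ (l : ℝ) * N + (t ⟨l, hln⟩ : ℕ) := by
      exact_mod_cast h3
    rw [thresholdAt, dif_pos hln]
    linarith
  have hat : thresholdAt t c = 2 * ((c : ℕ) * N + (t c : ℕ)) := by
    rw [thresholdAt, dif_pos c.2]
  -- At `(y, 1)` the score increases by `y - thresholdAt t l` from label `l` to `l + 1`; these
  -- increments turn from positive to negative once.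
  refine argmaxLabel_of_increments _
    (fun l => (2 * (((c : ℕ) : ℝ) * N + (u : ℕ)) + 1) - thresholdAt t l) (fun i => ?_) _ ?_ ?_
  · simp [thresholdTarget, lineScore, Finset.sum_sub_distrib]
    ring
  · intro l hl
    split_ifs at hl with htu
    · rcases (Nat.lt_succ_iff_lt_or_eq.1 (show l < (c : ℕ) + 1 from hl)) with h | rfl
      · exact hbefore l h
      · have : ((t c : ℕ) : ℝ) ≤ (u : ℕ) := by exact_mod_cast htu
        simp only [hat]
        linarith
    · exact hbefore l hl
  · intro l hl hln
    have hln : l < n := by omega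
    split_ifs at hl with htu
    · exact hafter l (by simpa using hl) hln
    · rcases Nat.eq_or_lt_of_le (show (c : ℕ) ≤ l from hl) with rfl | h
      · have : ((u : ℕ) : ℝ) + 1 ≤ (t c : ℕ) := by exact_mod_cast not_le.1 htu
        simp only [hat]
        linarith
      · exact hafter l h hln

theorem thresholdTarget_labels_injective {n N : ℕ} {t t' : Fin n → Fin N}
    (h : ∀ c u, argmaxLabel (thresholdTarget t ![2 * ((c : Fin n) * N + ((u : Fin N) : ℕ)) + 1, 1]) =
      argmaxLabel (thresholdTarget t' ![2 * (c * N + (u : ℕ)) + 1, 1])) : t = t' := by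
  have key : ∀ c u, t c ≤ u ↔ t' c ≤ u := by
    intro c u
    have := h c u
    rw [argmaxLabel_thresholdTarget, argmaxLabel_thresholdTarget] at this
    have hne : c.succ ≠ c.castSucc := by simp [Fin.ext_iff]
    grind
  funext c
  exact le_antisymm ((key c _).2 le_rfl) ((key c _).1 le_rfl)

/-! ### Lower bounds for simulated argmax learners -/

section LowerBound

variable {X : Set (Fin 2 → ℝ)} {Ω : Type} [MeasurableSpace Ω] {ρ : Measure Ω}
  [IsProbabilityMeasure ρ] {A : ActiveLearner 2 (argmaxSupervision 2) Ω} {qArg : ℝ → ℕ → ℕ}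
  {T : ∀ (k : ℕ) [NeZero k], QueryTree (Fin k × Fin k) Bool (Fin k)} {q : ℝ → ℕ → ℕ}

theorem groups_counting_bound (hX : {x : Fin 2 → ℝ | x 1 = 1} ⊆ X)
    (hA : LearnsWithQueries X (linearClass 2) (argmaxSupervision 2) ρ A qArg)
    (hT : ∀ (k : ℕ) [NeZero k], IsTournament (T k))
    (hq : LearnsWithQueries X (linearClass 2) (comparisonSupervision 2) ρ
      (simulateByTournaments A T) q)
    {k : ℕ} {ε : ℝ} (hk : 2 ≤ k) (hε : 0 < ε) (hε2 : ε ≤ 1 / 2) {M g : ℕ} (c : ℕ) (hM : 0 < M)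
    (h : M * g ≤ k) :
    7 * g ^ M * (c + 1) ^ ((M + 1) / 2) ≤ 8 * (g + c) ^ M * k ^ (q ε k / (k - 1)) := by
  have : NeZero k := ⟨by omega⟩
  have : NeZero M := ⟨by omega⟩
  set e := (c + 1) ^ ((M + 1) / 2) with he
  have hepos : 0 < e := pow_pos (Nat.succ_pos c) _
  have := card_targets_le hA hT hq hk hε (by linarith)
    (fun p : Fin M => ![((p : ℕ) : ℝ), 1]) (fun p => hX (by simp))
    (tangentTarget h) (fun t => lineScore_mem_linearClass _ _) ((g + c) ^ M / e) (fun l => by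
      rw [Nat.le_div_iff_mul_le hepos]
      simp only [argmaxLabel_tangentTarget]
      exact ncard_half_agree_mul_le (groupLabel h) (groupLabel_injective h) l hε2)
  rw [Fintype.card_fun, Fintype.card_fin, Fintype.card_fin] at this
  calc 7 * g ^ M * e ≤ 8 * ((g + c) ^ M / e * k ^ (q ε k / (k - 1))) * e :=
        Nat.mul_le_mul_right e this
    _ = 8 * ((g + c) ^ M / e * e) * k ^ (q ε k / (k - 1)) := by ring
    _ ≤ _ := by
        gcongr
        exact Nat.div_mul_le_self _ _

/-- Under the uniform distribution on the `n * N` test points, `hεN` makes loss at most `ε` mean no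
error at all. The labels determine the thresholds, so `B = 1`. -/
theorem thresholds_counting_bound (hX : {x : Fin 2 → ℝ | x 1 = 1} ⊆ X)
    (hA : LearnsWithQueries X (linearClass 2) (argmaxSupervision 2) ρ A qArg)
    (hT : ∀ (k : ℕ) [NeZero k], IsTournament (T k))
    (hq : LearnsWithQueries X (linearClass 2) (comparisonSupervision 2) ρ
      (simulateByTournaments A T) q)
    {n : ℕ} {ε : ℝ} (hn : 0 < n) (hε : 0 < ε) (hε1 : ε < 1) {N : ℕ} (hN : 0 < N)
    (hεN : ε * (n * N) < 1) :
    7 * N ^ n ≤ 8 * (n + 1) ^ (q ε (n + 1) / n) := by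
  have : NeZero n := ⟨by omega⟩
  have : NeZero N := ⟨by omega⟩
  have := card_targets_le hA hT hq (k := n + 1) (by omega) hε hε1
    (fun p : Fin n × Fin N => ![2 * ((p.1 : ℕ) * N + (p.2 : ℕ)) + 1, 1])
    (fun p => hX (by simp))
    thresholdTarget (fun t => lineScore_mem_linearClass _ _) 1 (fun l => by
      rw [Set.ncard_le_one]
      have hall : ∀ t : Fin n → Fin N,
          ({i : Fin n × Fin N | l i ≠ argmaxLabel (thresholdTarget t
            ![2 * ((i.1 : ℕ) * N + (i.2 : ℕ)) + 1, 1])}.ncard : ℝ) ≤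
              ε * Fintype.card (Fin n × Fin N) →
          ∀ i : Fin n × Fin N, l i = argmaxLabel (thresholdTarget t
            ![2 * ((i.1 : ℕ) * N + (i.2 : ℕ)) + 1, 1]) := by
        intro t ht
        rw [Fintype.card_prod, Fintype.card_fin, Fintype.card_fin, Nat.cast_mul] at ht
        have h0 := ht.trans_lt hεN
        rw [Nat.cast_lt_one, Set.ncard_eq_zero, Set.eq_empty_iff_forall_notMem] at h0
        exact fun i => not_not.1 (h0 i)
      intro t ht t' ht'
      exact thresholdTarget_labels_injective fun c u =>
        (hall t ht (c, u)).symm.trans (hall t' ht' (c, u)))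
  rw [Fintype.card_fun, Fintype.card_fin, Fintype.card_fin] at this
  simpa using this

/-! ### From the counting bounds to logarithms -/

theorem log_lower_bound_of_groups {k Q : ℕ} (hk : 2 ≤ k)
    (h : ∀ M g c : ℕ, 0 < M → M * g ≤ k →
      7 * g ^ M * (c + 1) ^ ((M + 1) / 2) ≤ 8 * (g + c) ^ M * k ^ Q) :
    k * Real.log 2 / 64 ≤ Q * Real.log k := by
  have hl2 : 0 < Real.log 2 := Real.log_pos (by norm_num)
  have hk2 : (2 : ℝ) ≤ k := by exact_mod_cast hk
  have hlk : Real.log 2 ≤ Real.log k := Real.log_le_log (by norm_num) hk2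
  rcases lt_or_ge k 16 with hlt | hge
  -- One point with two labels: `Q = 0` would give `56 ≤ 40`. For `k < 16`, `1 ≤ Q` is enough.
  · have h1 := h 1 2 3 one_pos (by omega)
    have hQ : 1 ≤ Q := by
      by_contra hQ
      obtain rfl : Q = 0 := by omega
      norm_num at h1
    have hQ' : (1 : ℝ) ≤ Q := by exact_mod_cast hQ
    have hk16 : (k : ℝ) ≤ 16 := by exact_mod_cast hlt.le
    nlinarith
  · have hM : 1 ≤ k / 16 := by omega
    have hMk : k ≤ 31 * (k / 16) := by omega
    set M := k / 16
    -- With `g = 16` and `c = 15` the two sides grow like `64 ^ M` and `31 ^ M`, and the ratio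
    -- exceeds 2.
    have h1 := h M 16 15 hM (by omega)
    have h4 : 4 ^ M ≤ (15 + 1) ^ ((M + 1) / 2) := by
      calc 4 ^ M ≤ 4 ^ (2 * ((M + 1) / 2)) := Nat.pow_le_pow_right (by norm_num) (by omega)
        _ = _ := by rw [pow_mul]; norm_num
    have h2 : 7 * 2 ^ M * 31 ^ M ≤ 8 * k ^ Q * 31 ^ M := by
      calc 7 * 2 ^ M * 31 ^ M = 7 * 62 ^ M := by rw [mul_assoc, ← mul_pow]; norm_num
        _ ≤ 7 * 64 ^ M := by gcongr; norm_num
        _ = 7 * 16 ^ M * 4 ^ M := by rw [mul_assoc, ← mul_pow]; norm_num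
        _ ≤ 7 * 16 ^ M * (15 + 1) ^ ((M + 1) / 2) := Nat.mul_le_mul_left _ h4
        _ ≤ 8 * (16 + 15) ^ M * k ^ Q := h1
        _ = _ := by ring
    have h3 : (7 : ℝ) * 2 ^ M ≤ 8 * k ^ Q := by
      exact_mod_cast Nat.le_of_mul_le_mul_right h2 (by positivity)
    have h5 : (2 : ℝ) ^ M ≤ (k ^ Q) ^ 2 := by
      have h6 : (2 : ℝ) ≤ 2 ^ M := by simpa using pow_le_pow_right₀ (one_le_two (α := ℝ)) hM
      nlinarith
    have h6 := Real.log_le_log (by positivity) h5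
    rw [Real.log_pow, Real.log_pow, Real.log_pow] at h6
    have h7 : (k : ℝ) ≤ 31 * M := by exact_mod_cast hMk
    push_cast at h6
    nlinarith

theorem log_lower_bound_of_thresholds {n Q : ℕ} {ε : ℝ} (hn : 0 < n) (hε : 0 < ε)
    (hεn : 4 * (n + 1) ^ 2 * ε ≤ 1)
    (h : ∀ N : ℕ, 0 < N → ε * (n * N) < 1 → 7 * N ^ n ≤ 8 * (n + 1) ^ Q) :
    n * Real.log (1 / ε) / 4 ≤ Q * Real.log (n + 1) := by
  have hn1 : (1 : ℝ) ≤ n := by exact_mod_cast hn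
  -- Just small enough for `ε * n * N < 1`; by `hεn` it is still at least `1 / √ε`, see `hsq`.
  set N := ⌊1 / (ε * (n + 1))⌋₊ with hNdef
  have hpos : 0 < ε * (n + 1) := by positivity
  have hbig : 2 ≤ 1 / (ε * (n + 1)) := by
    rw [le_div_iff₀ hpos]; nlinarith
  have hNle : (N : ℝ) ≤ 1 / (ε * (n + 1)) := Nat.floor_le (by positivity)
  have hNge : 1 / (2 * (ε * (n + 1))) ≤ N := by
    have := Nat.lt_floor_add_one (1 / (ε * (n + 1)))
    have h2 : 1 / (2 * (ε * (n + 1))) = 1 / (ε * (n + 1)) / 2 := by field_simp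
    rw [h2]; linarith
  have hN0 : (0 : ℝ) < N := lt_of_lt_of_le (by positivity) hNge
  have hN : 0 < N := by exact_mod_cast hN0
  have hNn : ε * (n * N) < 1 := by
    rw [le_div_iff₀ hpos] at hNle
    nlinarith
  have h1 : (7 : ℝ) * N ^ n ≤ 8 * (n + 1) ^ Q := by exact_mod_cast h N hN hNn
  have hsq : 1 / ε ≤ (N : ℝ) ^ 2 := by
    calc 1 / ε ≤ (1 / (2 * (ε * (n + 1)))) ^ 2 := by
          rw [div_pow, one_pow, div_le_div_iff₀ hε (by positivity)]
          nlinarith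
      _ ≤ _ := by gcongr
  have hL : 4 * Real.log 2 ≤ Real.log (1 / ε) := by
    have : Real.log (2 ^ 4) ≤ Real.log (1 / ε) := by
      refine Real.log_le_log (by norm_num) ?_
      rw [le_div_iff₀ hε]; nlinarith
    rwa [Real.log_pow] at this
  have hlN : Real.log (1 / ε) ≤ 2 * Real.log N := by
    have := Real.log_le_log (by positivity) hsq
    rwa [Real.log_pow] at this
  have h2 : Real.log ((N : ℝ) ^ n) ≤ Real.log (2 * (n + 1) ^ Q) :=
    Real.log_le_log (by positivity) (by nlinarith [pow_pos (show (0 : ℝ) < n + 1 by positivity) Q])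
  rw [Real.log_pow, Real.log_mul (by norm_num) (by positivity), Real.log_pow] at h2
  have hl2 : 0 < Real.log 2 := Real.log_pos (by norm_num)
  nlinarith

theorem simulated_argmax_lower_bound (hX : {x : Fin 2 → ℝ | x 1 = 1} ⊆ X)
    (hA : LearnsWithQueries X (linearClass 2) (argmaxSupervision 2) ρ A qArg)
    (hT : ∀ (k : ℕ) [NeZero k], IsTournament (T k))
    (hq : LearnsWithQueries X (linearClass 2) (comparisonSupervision 2) ρ
      (simulateByTournaments A T) q)
    {k : ℕ} {ε : ℝ} (hk : 2 ≤ k) (hε : 0 < ε) (hε2 : ε ≤ 1 / 2) :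
    Real.log 2 / 512 * ((k : ℝ) ^ 2 * Real.log (1 / ε)) / Real.log k ^ 2 ≤ q ε k := by
  have hl2 : 0 < Real.log 2 := Real.log_pos (by norm_num)
  have hk2 : (2 : ℝ) ≤ k := by exact_mod_cast hk
  have hlk : Real.log 2 ≤ Real.log k := Real.log_le_log (by norm_num) hk2
  have hlk0 : 0 < Real.log k := hl2.trans_le hlk
  have hL0 : 0 < Real.log (1 / ε) := Real.log_pos (by rw [lt_div_iff₀ hε]; linarith)
  obtain ⟨n, rfl⟩ : ∃ n, k = n + 1 := ⟨k - 1, by omega⟩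
  have hn : 0 < n := by omega
  have hn1 : (1 : ℝ) ≤ n := by exact_mod_cast hn
  have hQ : ((q ε (n + 1) / n : ℕ) : ℝ) * n ≤ q ε (n + 1) := by
    exact_mod_cast Nat.div_mul_le_self _ _
  set Q := q ε (n + 1) / n
  have hA1 := log_lower_bound_of_groups (Q := Q) hk fun M g c hM h =>
    groups_counting_bound hX hA hT hq hk hε hε2 c hM h
  rw [div_le_iff₀ (by positivity)]
  push_cast at *
  have hqk : Q * Real.log (n + 1) * (n + 1) / 2 ≤ q ε (n + 1) * Real.log (n + 1) := by
    have : (Q : ℝ) * (n + 1) / 2 ≤ q ε (n + 1) := by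
      nlinarith [Nat.cast_nonneg (α := ℝ) Q]
    nlinarith
  rw [pow_two (Real.log _), ← mul_assoc (q ε (n + 1) : ℝ)]
  -- Thresholds serve `ε ≤ 1 / (4 k²)`. Otherwise `log (1/ε) ≤ 2 log 2 + 2 log k ≤ 4 log k`, and the
  -- bound from groups loses only this factor.
  rcases le_or_gt (4 * ((n : ℝ) + 1) ^ 2 * ε) 1 with hs | hs
  · have hB1 := log_lower_bound_of_thresholds (Q := Q) hn hε hs fun N hN h =>
      thresholds_counting_bound hX hA hT hq hn hε (by linarith) hN h
    have h1 : ((n : ℝ) + 1) ^ 2 * Real.log (1 / ε) / 16 ≤ q ε (n + 1) * Real.log (n + 1) := by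
      refine le_trans ?_ hqk
      have := mul_le_mul_of_nonneg_right hB1 (show (0 : ℝ) ≤ (n + 1) / 2 by positivity)
      nlinarith [mul_pos hL0 (show (0 : ℝ) < n + 1 by positivity)]
    have h2 := mul_le_mul h1 hlk hl2.le (le_trans (by positivity) h1)
    refine le_trans ?_ h2
    have : 0 < ((n : ℝ) + 1) ^ 2 * Real.log (1 / ε) * Real.log 2 := by positivity
    linarith
  · have hL : Real.log (1 / ε) ≤ 4 * Real.log (n + 1) := by
      have h4 : Real.log (1 / ε) ≤ Real.log (2 ^ 2 * (n + 1) ^ 2) := by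
        refine Real.log_le_log (by positivity) ?_
        rw [div_le_iff₀ hε]; linarith
      rw [Real.log_mul (by positivity) (by positivity), Real.log_pow, Real.log_pow] at h4
      push_cast at h4
      linarith
    have h1 : ((n : ℝ) + 1) ^ 2 * Real.log 2 / 128 ≤ q ε (n + 1) * Real.log (n + 1) := by
      refine le_trans ?_ hqk
      have := mul_le_mul_of_nonneg_right hA1 (show (0 : ℝ) ≤ (n + 1) / 2 by positivity)
      linarith
    have h2 := mul_le_mul h1 hL hL0.le (le_trans (by positivity) h1)
    linarith

end LowerBound

/-! ### Binary search by queries -/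

namespace QueryTree

variable {Q ι κ : Type}

/-- Binary search for the last position at which the answer is `v`, in a window of length `2 ^ e`
that starts at `lo`. -/
def bisect (v : Bool) (qry : ℕ → Q) : ℕ → ℕ → QueryTree Q Bool ℕ
  | 0, lo => output lo
  | e + 1, lo => ask (qry (lo + 2 ^ e)) fun b =>
      if b = v then bisect v qry e (lo + 2 ^ e) else bisect v qry e lo

theorem cost_bisect (o : Q → Bool) (v : Bool) (qry : ℕ → Q) (e lo : ℕ) :
    (bisect v qry e lo).cost o = e := by
  induction e generalizing lo with
  | zero => rfl
  | succ e ih =>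
    simp only [bisect, cost]
    split_ifs <;> rw [ih]

/-- The invariant is that the window starts at a position with answer `v`; by `hanti` the positions
with answer `v` form an initial segment. -/
theorem run_bisect (o : Q → Bool) (v : Bool) (qry : ℕ → Q)
    (hanti : ∀ p p', p ≤ p' → o (qry p') = v → o (qry p) = v) (e lo : ℕ) (hlo : o (qry lo) = v)
    (p : ℕ) (hp : lo ≤ p) (hp' : p < lo + 2 ^ e) :
    o (qry p) = v ↔ p ≤ (bisect v qry e lo).run o := by
  have hrun : ∀ e lo, lo ≤ (bisect v qry e lo).run o := by
    intro e
    induction e with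
    | zero => intro lo; exact le_rfl
    | succ e ih =>
      intro lo
      simp only [bisect, run]
      split_ifs
      · exact (Nat.le_add_right _ _).trans (ih _)
      · exact ih _
  have hlt : ∀ e lo, (bisect v qry e lo).run o < lo + 2 ^ e := by
    intro e
    induction e with
    | zero => intro lo; exact Nat.lt_succ_self lo
    | succ e ih =>
      intro lo
      simp only [bisect, run, pow_succ]
      split_ifs
      · have := ih (lo + 2 ^ e); omega
      · have := ih lo; omega
  induction e generalizing lo with
  | zero =>
    obtain rfl : p = lo := by simp at hp'; omega
    simp [bisect, run, hlo]
  | succ e ih =>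
    simp only [bisect, run]
    rw [pow_succ] at hp'
    split_ifs with h
    · rcases lt_or_ge p (lo + 2 ^ e) with hlt' | hge
      · exact iff_of_true (hanti _ _ hlt'.le h) (hlt'.le.trans (hrun _ _))
      · exact ih _ h hge (by omega)
    · rcases lt_or_ge p (lo + 2 ^ e) with hlt' | hge
      · exact ih _ hlo hp hlt'
      · exact iff_of_false (fun h' => h (hanti _ _ hge h')) (not_le.2 ((hlt _ _).trans_le hge))

/-- Determine a predicate on a sorted list, provided that it is monotone or antitone. -/
def thresholdSearch [DecidableEq ι] (qry : ι → Q) (e : ℕ) : List ι → QueryTree Q Bool (ι → Bool)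
  | [] => output fun _ => false
  | x :: l => ask (qry x) fun v =>
      (bisect v (fun p => qry ((x :: l)[min p l.length]'(by simp))) e 0).bind fun r =>
        output fun y => if (x :: l).idxOf y ≤ r then v else !v

/-- Empty lists being free allows `mergeWinners` to run over all conceivable blocks and to pay only
for those that contain a point. -/
theorem cost_thresholdSearch_le [DecidableEq ι] (o : Q → Bool) (qry : ι → Q) (e : ℕ)
    (l : List ι) : (thresholdSearch qry e l).cost o ≤ if l = [] then 0 else e + 1 := by
  cases l with
  | nil => simp [thresholdSearch, cost]
  | cons x l => simp [thresholdSearch, cost, cost_bind, cost_bisect]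

/-- The direction of monotonicity need not be known: in both cases the points that answer like the
first one form an initial segment. Clamped positions repeat the last point and pad the list to
length `2 ^ e`. -/
theorem run_thresholdSearch [DecidableEq ι] (o : Q → Bool) (qry : ι → Q) (e : ℕ) (key : ι → ℝ)
    (l : List ι) (hl : l.Pairwise fun x y => key x ≤ key y) (he : l.length ≤ 2 ^ e)
    (hmono : (∀ x ∈ l, ∀ y ∈ l, key x ≤ key y → o (qry x) = true → o (qry y) = true) ∨
      ∀ x ∈ l, ∀ y ∈ l, key x ≤ key y → o (qry y) = true → o (qry x) = true)
    (y : ι) (hy : y ∈ l) : (thresholdSearch qry e l).run o y = o (qry y) := by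
  cases l with
  | nil => simp at hy
  | cons x l =>
    have hlen : ∀ p, min p l.length < (x :: l).length := fun p => by simp
    have hkey : ∀ p p', p ≤ p' →
        key ((x :: l)[min p l.length]'(hlen p)) ≤ key ((x :: l)[min p' l.length]'(hlen p')) := by
      intro p p' hpp
      rcases (show min p l.length ≤ min p' l.length by omega).eq_or_lt with h | h
      · simp [h]
      · exact List.pairwise_iff_getElem.1 hl _ _ _ _ h
    have hanti : ∀ p p', p ≤ p' →
        o (qry ((x :: l)[min p' l.length]'(hlen p'))) = o (qry x) →
        o (qry ((x :: l)[min p l.length]'(hlen p))) = o (qry x) := by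
      intro p p' hpp h
      have h0 := hkey 0 p (Nat.zero_le _)
      have h1 := hkey p p' hpp
      have hx : (x :: l)[min 0 l.length]'(hlen 0) = x := by simp
      rw [hx] at h0
      have mx : x ∈ x :: l := by simp
      have mp := List.getElem_mem (hlen p)
      have mp' := List.getElem_mem (hlen p')
      rcases hmono with hm | hm
      · have a := hm _ mx _ mp h0
        have b := hm _ mp _ mp' h1
        cases hv : o (qry x) <;> simp_all
      · have a := hm _ mx _ mp h0
        have b := hm _ mp _ mp' h1
        cases hv : o (qry x) <;> simp_all
    have hidx : (x :: l).idxOf y < (x :: l).length := List.idxOf_lt_length_of_mem hy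
    have hmin : min ((x :: l).idxOf y) l.length = (x :: l).idxOf y := by
      simp only [List.length_cons] at hidx; omega
    have hget : (x :: l)[min ((x :: l).idxOf y) l.length]'(hlen _) = y := by
      simp only [hmin, List.getElem_idxOf]
    have key := run_bisect o (o (qry x))
      (fun p => qry ((x :: l)[min p l.length]'(hlen p))) hanti e 0 (by simp)
      ((x :: l).idxOf y) (Nat.zero_le _) (by omega)
    simp only [hget] at key
    simp only [thresholdSearch, run, run_bind]
    by_cases h : o (qry y) = o (qry x)
    · rw [if_pos (key.1 h), h]
    · rw [if_neg (mt key.2 h)]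
      exact (Bool.eq_not.2 h).symm

/-- Run the procedures `t b` for all blocks `b` of a list, and combine the results. -/
def blockwise [DecidableEq κ] (blk : ι → κ) (t : κ → QueryTree Q Bool (ι → Bool)) :
    List κ → QueryTree Q Bool (ι → Bool)
  | [] => output fun _ => false
  | b :: l => (t b).bind fun r => (blockwise blk t l).bind fun r' =>
      output fun y => if blk y = b then r y else r' y

theorem cost_blockwise [DecidableEq κ] (o : Q → Bool) (blk : ι → κ)
    (t : κ → QueryTree Q Bool (ι → Bool)) (l : List κ) :
    (blockwise blk t l).cost o = (l.map fun b => (t b).cost o).sum := by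
  induction l with
  | nil => rfl
  | cons b l ih => simp [blockwise, cost_bind, ih, cost]

theorem run_blockwise [DecidableEq κ] (o : Q → Bool) (blk : ι → κ)
    (t : κ → QueryTree Q Bool (ι → Bool)) (l : List κ) (y : ι) (hy : blk y ∈ l) :
    (blockwise blk t l).run o y = (t (blk y)).run o y := by
  induction l with
  | nil => simp at hy
  | cons b l ih =>
    simp only [blockwise, run_bind, run]
    split_ifs with h
    · rw [h]
    · exact ih (by simpa [h] using hy)

end QueryTree

/-! ### Winners of dyadic blocks of labels -/

/-- The label `i`, or the last label if `i` is too large. -/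
def clampLabel (k : ℕ) [NeZero k] (i : ℕ) : Fin k :=
  ⟨min i (k - 1), by have := NeZero.pos k; omega⟩

/-- The label of maximal score among the labels `a * 2 ^ d, …, (a + 1) * 2 ^ d - 1`. -/
noncomputable def blockWinner {k : ℕ} [NeZero k] (s : Fin k → ℝ) : ℕ → ℕ → Fin k
  | 0, a => clampLabel k a
  | d + 1, a =>
    if s (blockWinner s d (2 * a)) < s (blockWinner s d (2 * a + 1)) then
      blockWinner s d (2 * a + 1)
    else blockWinner s d (2 * a)

/-- The labels `a * 2 ^ d, …, (a + 1) * 2 ^ d - 1`. -/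
def labelBlock (k : ℕ) [NeZero k] (d a : ℕ) : Finset (Fin k) :=
  (Finset.Ico (a * 2 ^ d) ((a + 1) * 2 ^ d)).image (clampLabel k)

theorem card_labelBlock_le (k : ℕ) [NeZero k] (d a : ℕ) : (labelBlock k d a).card ≤ 2 ^ d := by
  refine Finset.card_image_le.trans ?_
  rw [Nat.card_Ico, ← Nat.sub_mul]
  simp

theorem labelBlock_succ (k : ℕ) [NeZero k] (d a : ℕ) :
    labelBlock k (d + 1) a = labelBlock k d (2 * a) ∪ labelBlock k d (2 * a + 1) := by
  rw [labelBlock, labelBlock, labelBlock, ← Finset.image_union,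
    Finset.Ico_union_Ico_eq_Ico (by gcongr; omega) (by gcongr; omega)]
  ring_nf

theorem clampLabel_mono (k : ℕ) [NeZero k] {i j : ℕ} (h : i ≤ j) :
    clampLabel k i ≤ clampLabel k j :=
  Fin.mk_le_mk.2 (min_le_min_right _ h)

theorem labelBlock_le {k : ℕ} [NeZero k] {d a : ℕ} {i j : Fin k}
    (hi : i ∈ labelBlock k d (2 * a)) (hj : j ∈ labelBlock k d (2 * a + 1)) : i ≤ j := by
  obtain ⟨i', hi', rfl⟩ := Finset.mem_image.1 hi
  obtain ⟨j', hj', rfl⟩ := Finset.mem_image.1 hj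
  exact clampLabel_mono k ((Finset.mem_Ico.1 hi').2.le.trans (Finset.mem_Ico.1 hj').1)

/-- The right half wins only by a strict inequality and its labels are never smaller than those of
the left half, so ties go to the smallest label. Halves may share the clamped last label, which does
no harm. -/
theorem blockWinner_eq_iff {k : ℕ} [NeZero k] (s : Fin k → ℝ) (d a : ℕ) (w : Fin k) :
    blockWinner s d a = w ↔ w ∈ labelBlock k d a ∧ (∀ j ∈ labelBlock k d a, s j ≤ s w) ∧
      ∀ j ∈ labelBlock k d a, j < w → s j < s w := by
  have hspec : blockWinner s d a ∈ labelBlock k d a ∧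
      (∀ j ∈ labelBlock k d a, s j ≤ s (blockWinner s d a)) ∧
      ∀ j ∈ labelBlock k d a, j < blockWinner s d a → s j < s (blockWinner s d a) := by
    induction d generalizing a with
    | zero => simp [blockWinner, labelBlock]
    | succ d ih =>
      obtain ⟨m₁, l₁, t₁⟩ := ih (2 * a)
      obtain ⟨m₂, l₂, t₂⟩ := ih (2 * a + 1)
      rw [labelBlock_succ, blockWinner]
      simp only [Finset.mem_union]
      split_ifs with h
      · exact ⟨Or.inr m₂, fun j hj => hj.elim (fun hj => (l₁ j hj).trans h.le) (l₂ j),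
          fun j hj hlt => hj.elim (fun hj => (l₁ j hj).trans_lt h) fun hj => t₂ j hj hlt⟩
      · exact ⟨Or.inl m₁, fun j hj => hj.elim (l₁ j) fun hj => (l₂ j hj).trans (not_lt.1 h),
          fun j hj hlt => hj.elim (fun hj => t₁ j hj hlt) fun hj =>
            absurd (labelBlock_le m₁ hj) (not_le.2 hlt)⟩
  constructor
  · rintro rfl
    exact hspec
  · rintro ⟨m, l, t⟩
    obtain ⟨m', l', t'⟩ := hspec
    refine le_antisymm ?_ ?_
    · by_contra h
      exact absurd (l _ m') (not_le.2 (t' _ m (not_le.1 h)))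
    · by_contra h
      exact absurd (l' _ m) (not_le.2 (t _ m' (not_le.1 h)))

theorem blockWinner_eq_argmaxLabel {k : ℕ} [NeZero k] (s : Fin k → ℝ) (d : ℕ) (hd : k ≤ 2 ^ d) :
    blockWinner s d 0 = argmaxLabel s := by
  have hmem : ∀ j, j ∈ labelBlock k d 0 := by
    intro j
    refine Finset.mem_image.2 ⟨j, by simp; omega, Fin.ext ?_⟩
    simp only [clampLabel]
    omega
  rw [eq_comm, argmaxLabel_eq_iff]
  obtain ⟨-, h1, h2⟩ := (blockWinner_eq_iff s d 0 _).1 rfl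
  exact ⟨fun j => h1 j (hmem j), fun j => h2 j (hmem j)⟩

/-! ### Score functions with monotone comparisons -/

/-- On each class of points, all comparisons of labels are monotone or antitone in `key`. -/
def MonotoneComparisons {ι κ : Type*} {k : ℕ} (cls : ι → κ) (key : ι → ℝ)
    (s : ι → Fin k → ℝ) : Prop :=
  ∀ c i j,
    (∀ x y, cls x = c → cls y = c → key x ≤ key y → s x i < s x j → s y i < s y j) ∨
    ∀ x y, cls x = c → cls y = c → key x ≤ key y → s y i < s y j → s x i < s x j

namespace MonotoneComparisons

variable {ι κ : Type*} {k : ℕ} {cls : ι → κ} {key : ι → ℝ} {s : ι → Fin k → ℝ}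

theorem lt_of_between (h : MonotoneComparisons cls key s) {x y z : ι} (hxy : cls y = cls x)
    (hzx : cls z = cls x) (h1 : key x ≤ key y) (h2 : key y ≤ key z) {i j : Fin k}
    (hx : s x i < s x j) (hz : s z i < s z j) : s y i < s y j := by
  rcases h (cls x) i j with hm | hm
  · exact hm x y rfl hxy h1 hx
  · exact hm y z hxy hzx h2 hz

theorem le_of_between (h : MonotoneComparisons cls key s) {x y z : ι} (hxy : cls y = cls x)
    (hzx : cls z = cls x) (h1 : key x ≤ key y) (h2 : key y ≤ key z) {i j : Fin k}
    (hx : s x i ≤ s x j) (hz : s z i ≤ s z j) : s y i ≤ s y j := by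
  by_contra hy
  rw [not_le] at hy
  rcases h (cls x) j i with hm | hm
  · exact absurd (hm y z hxy hzx h2 hy) (not_lt.2 hz)
  · exact absurd (hm x y rfl hxy h1 hy) (not_lt.2 hx)

/-- To win is a conjunction of weak and strict comparisons, and each of them passes from two points
to any point between them. So winning regions are intervals. -/
theorem blockWinner_between [NeZero k] (h : MonotoneComparisons cls key s) {x y z : ι}
    (hxy : cls y = cls x) (hzx : cls z = cls x) (h1 : key x ≤ key y) (h2 : key y ≤ key z)
    (d a : ℕ) (hw : blockWinner (s x) d a = blockWinner (s z) d a) :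
    blockWinner (s y) d a = blockWinner (s x) d a := by
  obtain ⟨m, l, t⟩ := (blockWinner_eq_iff (s x) d a _).1 rfl
  obtain ⟨-, l', t'⟩ := (blockWinner_eq_iff (s z) d a _).1 hw.symm
  exact (blockWinner_eq_iff _ _ _ _).2 ⟨m,
    fun j hj => h.le_of_between hxy hzx h1 h2 (l j hj) (l' j hj),
    fun j hj hlt => h.lt_of_between hxy hzx h1 h2 (t j hj hlt) (t' j hj hlt)⟩

theorem argmaxLabel_between [NeZero k] (h : MonotoneComparisons cls key s) {x y z : ι}
    (hxy : cls y = cls x) (hzx : cls z = cls x) (h1 : key x ≤ key y) (h2 : key y ≤ key z)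
    (hw : argmaxLabel (s x) = argmaxLabel (s z)) : argmaxLabel (s y) = argmaxLabel (s x) := by
  have hd := (Nat.lt_two_pow_self (n := k)).le
  simp only [← blockWinner_eq_argmaxLabel _ k hd] at hw ⊢
  exact h.blockWinner_between hxy hzx h1 h2 _ _ hw

theorem comp {ι' : Type*} (h : MonotoneComparisons cls key s) (g : ι' → ι) :
    MonotoneComparisons (cls ∘ g) (key ∘ g) (s ∘ g) := fun c i j =>
  (h c i j).imp (fun hm x y => hm (g x) (g y)) fun hm x y => hm (g x) (g y)

end MonotoneComparisons

/-- The common refinement of two partitions into intervals has at most as many parts as the two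
partitions together. -/
theorem card_image_refinement_le {ι κ α β : Type*} [DecidableEq κ] [DecidableEq α]
    [DecidableEq β] (P : Finset ι) (cls : ι → κ) (key : ι → ℝ) (g₁ : ι → α) (g₂ : ι → β)
    (h₁ : ∀ x ∈ P, ∀ y ∈ P, ∀ z ∈ P, cls y = cls x → cls z = cls x → key x ≤ key y →
      key y ≤ key z → g₁ x = g₁ z → g₁ y = g₁ x)
    (h₂ : ∀ x ∈ P, ∀ y ∈ P, ∀ z ∈ P, cls y = cls x → cls z = cls x → key x ≤ key y →
      key y ≤ key z → g₂ x = g₂ z → g₂ y = g₂ x) :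
    (P.image fun y => (cls y, g₁ y, g₂ y)).card ≤
      (P.image fun y => (cls y, g₁ y)).card + (P.image fun y => (cls y, g₂ y)).card := by
  classical
  rcases P.eq_empty_or_nonempty with rfl | ⟨y₀, -⟩
  · simp
  have : Nonempty ι := ⟨y₀⟩
  have hmin₁ : ∀ b ∈ P.image (fun y => (cls y, g₁ y)), ∃ u ∈ P, (cls u, g₁ u) = b ∧
      ∀ y ∈ P, (cls y, g₁ y) = b → key u ≤ key y := by
    intro b hb
    obtain ⟨y, hy, hyb⟩ := Finset.mem_image.1 hb
    obtain ⟨u, hu, hmin⟩ := Finset.exists_min_image (P.filter fun y => (cls y, g₁ y) = b) key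
      ⟨y, Finset.mem_filter.2 ⟨hy, hyb⟩⟩
    obtain ⟨hu, hub⟩ := Finset.mem_filter.1 hu
    exact ⟨u, hu, hub, fun y hy hyb => hmin y (Finset.mem_filter.2 ⟨hy, hyb⟩)⟩
  have hmin₂ : ∀ b ∈ P.image (fun y => (cls y, g₂ y)), ∃ u ∈ P, (cls u, g₂ u) = b ∧
      ∀ y ∈ P, (cls y, g₂ y) = b → key u ≤ key y := by
    intro b hb
    obtain ⟨y, hy, hyb⟩ := Finset.mem_image.1 hb
    obtain ⟨u, hu, hmin⟩ := Finset.exists_min_image (P.filter fun y => (cls y, g₂ y) = b) key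
      ⟨y, Finset.mem_filter.2 ⟨hy, hyb⟩⟩
    obtain ⟨hu, hub⟩ := Finset.mem_filter.1 hu
    exact ⟨u, hu, hub, fun y hy hyb => hmin y (Finset.mem_filter.2 ⟨hy, hyb⟩)⟩
  choose! u₁ hu₁ hb₁ hm₁ using hmin₁
  choose! u₂ hu₂ hb₂ hm₂ using hmin₂
  set blk : ι → κ × α × β := fun y => (cls y, g₁ y, g₂ y) with hblk
  -- A part of the refinement is the intersection of two intervals, and the later of their two first
  -- points lies in both. So every part contains the first point of a part of one of the two
  -- partitions.
  have hsub : P.image blk ⊆ ((P.image fun y => (cls y, g₁ y)).image fun b => blk (u₁ b)) ∪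
      ((P.image fun y => (cls y, g₂ y)).image fun b => blk (u₂ b)) := by
    intro b hb
    obtain ⟨y, hy, rfl⟩ := Finset.mem_image.1 hb
    have i₁ : (cls y, g₁ y) ∈ P.image fun y => (cls y, g₁ y) := Finset.mem_image_of_mem _ hy
    have i₂ : (cls y, g₂ y) ∈ P.image fun y => (cls y, g₂ y) := Finset.mem_image_of_mem _ hy
    obtain ⟨c₁, e₁⟩ := Prod.ext_iff.1 (hb₁ _ i₁)
    obtain ⟨c₂, e₂⟩ := Prod.ext_iff.1 (hb₂ _ i₂)
    have k₁ := hm₁ _ i₁ y hy rfl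
    have k₂ := hm₂ _ i₂ y hy rfl
    simp only at c₁ c₂ e₁ e₂
    rcases le_total (key (u₁ (cls y, g₁ y))) (key (u₂ (cls y, g₂ y))) with hle | hle
    · refine Finset.mem_union_right _ (Finset.mem_image.2 ⟨_, i₂, ?_⟩)
      have := h₁ _ (hu₁ _ i₁) _ (hu₂ _ i₂) _ hy (c₂.trans c₁.symm) c₁.symm hle k₂ e₁
      simp only [hblk, Prod.mk.injEq]
      exact ⟨c₂, this.trans e₁, e₂⟩
    · refine Finset.mem_union_left _ (Finset.mem_image.2 ⟨_, i₁, ?_⟩)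
      have := h₂ _ (hu₂ _ i₂) _ (hu₁ _ i₁) _ hy (c₁.trans c₂.symm) c₂.symm hle k₁ e₂
      simp only [hblk, Prod.mk.injEq]
      exact ⟨c₁, e₁, this.trans e₂⟩
  exact (Finset.card_le_card hsub).trans ((Finset.card_union_le _ _).trans
    (Nat.add_le_add Finset.card_image_le Finset.card_image_le))

/-! ### Labelling a pool by divide and conquer over the labels -/

section Envelope

variable {ι κ : Type} [DecidableEq ι] [DecidableEq κ] [Fintype κ] {k : ℕ}

/-- Given the winners `g₁` and `g₂` of two sets of labels at the points of a sorted list, find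
the winner of the union: on every block of the common refinement, a binary search suffices. -/
noncomputable def mergeWinners (cls : ι → κ) (pts : List ι) (e : ℕ) (g₁ g₂ : ι → Fin k) :
    QueryTree (ι × Fin k × Fin k) Bool (ι → Fin k) :=
  (QueryTree.blockwise (fun y => (cls y, g₁ y, g₂ y))
    (fun b => QueryTree.thresholdSearch (fun y => (y, b.2.2, b.2.1)) e
      (pts.filter fun y => (cls y, g₁ y, g₂ y) = b))
    (Finset.univ : Finset (κ × Fin k × Fin k)).toList).bind fun r =>
      QueryTree.output fun y => if r y then g₂ y else g₁ y

/-- Within a block the two labels to be compared are fixed, so `hs` applies. Correctness holds for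
arbitrary `g₁` and `g₂`; that their level sets are intervals matters only for the number of blocks.
-/
theorem run_mergeWinners (cls : ι → κ) (key : ι → ℝ) (s : ι → Fin k → ℝ)
    (hs : MonotoneComparisons cls key s) (pts : List ι)
    (hsort : pts.Pairwise fun x y => key x ≤ key y) (e : ℕ) (he : pts.length ≤ 2 ^ e)
    (g₁ g₂ : ι → Fin k) (y : ι) (hy : y ∈ pts) :
    (mergeWinners cls pts e g₁ g₂).run (fun p => compareScores (s p.1) p.2) y =
      if s y (g₁ y) < s y (g₂ y) then g₂ y else g₁ y := by
  simp only [mergeWinners, QueryTree.run_bind, QueryTree.run]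
  rw [QueryTree.run_blockwise _ _ _ _ _ (by simp),
    QueryTree.run_thresholdSearch _ _ _ key _ (hsort.filter _)
      ((List.length_filter_le _ _).trans he) _ _ (by simpa using hy)]
  · simp [compareScores]
  · simp only [List.mem_filter, decide_eq_true_eq, compareScores]
    refine (hs (cls y) (g₁ y) (g₂ y)).imp (fun hm x hx z hz => ?_) fun hm x hx z hz => ?_
    · exact hm x z (Prod.ext_iff.1 hx.2).1 (Prod.ext_iff.1 hz.2).1
    · exact hm x z (Prod.ext_iff.1 hx.2).1 (Prod.ext_iff.1 hz.2).1

theorem cost_mergeWinners_le (cls : ι → κ) (pts : List ι) (e : ℕ) (g₁ g₂ : ι → Fin k)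
    (o : ι × Fin k × Fin k → Bool) :
    (mergeWinners cls pts e g₁ g₂).cost o ≤
      (pts.toFinset.image fun y => (cls y, g₁ y, g₂ y)).card * (e + 1) := by
  simp only [mergeWinners, QueryTree.cost_bind, QueryTree.cost, add_zero,
    QueryTree.cost_blockwise, Finset.sum_map_toList]
  calc _ ≤ ∑ b : κ × Fin k × Fin k,
        if b ∈ pts.toFinset.image (fun y => (cls y, g₁ y, g₂ y)) then e + 1 else 0 := by
        refine Finset.sum_le_sum fun b _ => (QueryTree.cost_thresholdSearch_le _ _ _ _).trans ?_
        split_ifs with h1 h2 h2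
        · exact Nat.zero_le _
        · exact le_rfl
        · exact le_rfl
        · refine absurd (List.filter_eq_nil_iff.2 fun y hy hyb => h2 ?_) h1
          exact Finset.mem_image.2 ⟨y, by simpa using hy, by simpa using hyb⟩
    _ = _ := by
        rw [Finset.sum_ite_mem, Finset.univ_inter, Finset.sum_const, smul_eq_mul]

variable [NeZero k]

/-- Find the winners of a dyadic block of labels at all points of a sorted list. -/
noncomputable def envelope (cls : ι → κ) (pts : List ι) (e : ℕ) :
    ℕ → ℕ → QueryTree (ι × Fin k × Fin k) Bool (ι → Fin k)
  | 0, a => QueryTree.output fun _ => clampLabel k a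
  | d + 1, a => (envelope cls pts e d (2 * a)).bind fun g₁ =>
      (envelope cls pts e d (2 * a + 1)).bind fun g₂ => mergeWinners cls pts e g₁ g₂

theorem run_envelope (cls : ι → κ) (key : ι → ℝ) (s : ι → Fin k → ℝ)
    (hs : MonotoneComparisons cls key s) (pts : List ι)
    (hsort : pts.Pairwise fun x y => key x ≤ key y) (e : ℕ) (he : pts.length ≤ 2 ^ e) (d a : ℕ)
    (y : ι) (hy : y ∈ pts) :
    (envelope cls pts e d a).run (fun p => compareScores (s p.1) p.2) y =
      blockWinner (s y) d a := by
  induction d generalizing a with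
  | zero => rfl
  | succ d ih =>
    simp only [envelope, QueryTree.run_bind, blockWinner]
    rw [run_mergeWinners cls key s hs pts hsort e he _ _ y hy, ih, ih]

/-- The recursion is `T (d + 1) ≤ 2 T d + 2 |κ| 2 ^ d (e + 1)`: each half has at most `2 ^ d`
winners per class, and the refinement at most the sum of both counts. -/
theorem cost_envelope_le (cls : ι → κ) (key : ι → ℝ) (s : ι → Fin k → ℝ)
    (hs : MonotoneComparisons cls key s) (pts : List ι)
    (hsort : pts.Pairwise fun x y => key x ≤ key y) (e : ℕ) (he : pts.length ≤ 2 ^ e) (d a : ℕ) :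
    (envelope cls pts e d a).cost (fun p => compareScores (s p.1) p.2) ≤
      d * 2 ^ d * (Fintype.card κ * (e + 1)) := by
  induction d generalizing a with
  | zero => simp [envelope, QueryTree.cost]
  | succ d ih =>
    simp only [envelope, QueryTree.cost_bind]
    set o : ι × Fin k × Fin k → Bool := fun p => compareScores (s p.1) p.2
    have hrun : ∀ a, ∀ y ∈ pts.toFinset,
        (envelope cls pts e d a).run o y = blockWinner (s y) d a := fun a y hy =>
      run_envelope cls key s hs pts hsort e he d a y (by simpa using hy)
    have hconv : ∀ a, ∀ x ∈ pts.toFinset, ∀ y ∈ pts.toFinset, ∀ z ∈ pts.toFinset,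
        cls y = cls x → cls z = cls x → key x ≤ key y → key y ≤ key z →
        (envelope cls pts e d a).run o x = (envelope cls pts e d a).run o z →
        (envelope cls pts e d a).run o y = (envelope cls pts e d a).run o x := by
      intro a x hx y hy z hz c1 c2 k1 k2 hw
      rw [hrun a x hx, hrun a z hz] at hw
      rw [hrun a x hx, hrun a y hy]
      exact hs.blockWinner_between c1 c2 k1 k2 d a hw
    have hcard : ∀ a, (pts.toFinset.image fun y =>
        (cls y, (envelope cls pts e d a).run o y)).card ≤ Fintype.card κ * 2 ^ d := by
      intro a
      calc _ ≤ ((Finset.univ : Finset κ) ×ˢ labelBlock k d a).card := by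
            refine Finset.card_le_card fun b hb => ?_
            obtain ⟨y, hy, rfl⟩ := Finset.mem_image.1 hb
            rw [Finset.mem_product, hrun a y hy]
            exact ⟨Finset.mem_univ _, ((blockWinner_eq_iff (s y) d a _).1 rfl).1⟩
        _ ≤ _ := by
            rw [Finset.card_product, Finset.card_univ]
            exact Nat.mul_le_mul_left _ (card_labelBlock_le k d a)
    have hmerge := (cost_mergeWinners_le cls pts e
      ((envelope cls pts e d (2 * a)).run o) ((envelope cls pts e d (2 * a + 1)).run o) o).trans
      (Nat.mul_le_mul_right (e + 1) ((card_image_refinement_le pts.toFinset cls key _ _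
        (hconv (2 * a)) (hconv (2 * a + 1))).trans
        (Nat.add_le_add (hcard (2 * a)) (hcard (2 * a + 1)))))
    calc _ ≤ d * 2 ^ d * (Fintype.card κ * (e + 1)) + (d * 2 ^ d * (Fintype.card κ * (e + 1)) +
          (Fintype.card κ * 2 ^ d + Fintype.card κ * 2 ^ d) * (e + 1)) :=
          Nat.add_le_add (ih _) (Nat.add_le_add (ih _) hmerge)
      _ = _ := by ring

end Envelope

/-! ### Generalization from labelled samples -/

/-- The infimum of all `t` with `δ ≤ ν (Iic t)` works, by continuity of `ν` from below and from
above. A possible atom at `c` is the reason for the open and the closed ray. -/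
theorem exists_quantile (ν : Measure ℝ) [IsFiniteMeasure ν] {δ : ENNReal} (h0 : 0 < δ)
    (h1 : δ < ν Set.univ) : ∃ c, ν (Set.Iio c) ≤ δ ∧ δ ≤ ν (Set.Iic c) := by
  set A : Set ℝ := {t | δ ≤ ν (Set.Iic t)} with hA
  have hne : A.Nonempty := by
    obtain ⟨t, ht⟩ := ((tendsto_measure_Iic_atTop ν).eventually (lt_mem_nhds h1)).exists
    exact ⟨t, le_of_lt ht⟩
  have hbdd : BddBelow A := by
    have ht : Filter.Tendsto (fun t => ν (Set.Iic t)) Filter.atBot (nhds 0) := by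
      have := tendsto_measure_iInter_atBot (μ := ν) (s := fun t : ℝ => Set.Iic t)
        (fun t => measurableSet_Iic.nullMeasurableSet) monotone_Iic ⟨0, measure_ne_top _ _⟩
      have hempty : ⋂ t : ℝ, Set.Iic t = ∅ := by
        refine Set.eq_empty_iff_forall_notMem.2 fun x hx => ?_
        have := Set.mem_iInter.1 hx (x - 1)
        rw [Set.mem_Iic] at this
        linarith
      rwa [hempty, measure_empty] at this
    obtain ⟨t, ht⟩ := (ht.eventually (gt_mem_nhds h0)).exists
    refine ⟨t, fun s hs => ?_⟩
    by_contra hlt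
    exact absurd (le_trans hs (measure_mono (Set.Iic_subset_Iic.2 (not_le.1 hlt).le)))
      (not_le.2 ht)
  refine ⟨sInf A, ?_, ?_⟩
  · obtain ⟨u, hu, hlt, htend⟩ := exists_seq_strictMono_tendsto (sInf A)
    rw [← iUnion_Iic_eq_Iio_of_lt_of_tendsto hlt htend,
      Monotone.measure_iUnion fun i j hij => Set.Iic_subset_Iic.2 (hu.monotone hij)]
    refine iSup_le fun n => ?_
    by_contra h
    exact absurd (csInf_le hbdd (show u n ∈ A from (not_le.1 h).le)) (not_le.2 (hlt n))
  · have ht := tendsto_measure_biInter_gt (μ := ν) (s := fun t : ℝ => Set.Iic t) (a := sInf A)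
      (fun t _ => measurableSet_Iic.nullMeasurableSet)
      (fun _ _ _ hij => Set.Iic_subset_Iic.2 hij) ⟨sInf A + 1, by simp, measure_ne_top _ _⟩
    have hset : ⋂ r > sInf A, Set.Iic r = Set.Iic (sInf A) := by
      ext x
      simp only [Set.mem_iInter, Set.mem_Iic]
      exact ⟨fun h => le_of_forall_gt_imp_ge_of_dense h, fun h r hr => h.trans (le_of_lt hr)⟩
    rw [hset] at ht
    refine ge_of_tendsto ht ?_
    filter_upwards [self_mem_nhdsWithin] with t ht
    obtain ⟨a, ha, hat⟩ := exists_lt_of_csInf_lt hne ht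
    exact le_trans ha (measure_mono (Set.Iic_subset_Iic.2 hat.le))

/-- Some set of measure at least `δ` has the property that every sample that hits it leaves at
most `δ` of `I` below all its points in `I`. -/
theorem exists_hitting_set {β : Type*} [MeasurableSpace β] (D : Measure β)
    [IsProbabilityMeasure D] {I : Set β} (hI : MeasurableSet I) {key : β → ℝ}
    (hkey : Measurable key) {δ : ENNReal} (h0 : 0 < δ) (h1 : δ ≤ 1) :
    ∃ G, MeasurableSet G ∧ δ ≤ D G ∧ ∀ P : Set β, (∃ s ∈ P, s ∈ G) →
      D {x | x ∈ I ∧ ∀ s ∈ P, s ∈ I → key x < key s} ≤ δ := by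
  rcases le_or_gt (D I) δ with hle | hlt
  · exact ⟨Set.univ, MeasurableSet.univ, by simpa using h1,
      fun P _ => (measure_mono fun x hx => hx.1).trans hle⟩
  have happ : ∀ s, MeasurableSet s → ((D.restrict I).map key) s = D (key ⁻¹' s ∩ I) :=
    fun s hs => by rw [Measure.map_apply hkey hs, Measure.restrict_apply (hkey hs)]
  have : IsFiniteMeasure ((D.restrict I).map key) := by infer_instance
  obtain ⟨c, hc, hc'⟩ := exists_quantile ((D.restrict I).map key) h0
    (by rw [happ _ MeasurableSet.univ]; simpa using hlt)
  rw [happ _ measurableSet_Iio] at hc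
  rw [happ _ measurableSet_Iic] at hc'
  -- The hitting set is the closed lower tail of `I`; what lies below a sample point in it is
  -- contained in the open tail, of measure at most `δ`.
  refine ⟨_, (hkey measurableSet_Iic).inter hI, hc', fun P hP => ?_⟩
  obtain ⟨s, hsP, hsc, hsI⟩ := hP
  refine le_trans (measure_mono fun x hx => ?_) hc
  exact ⟨(hx.2 s hsP hsI).trans_le hsc, hx.1⟩

/-- A hypothesis that agrees with the target on a sample that hits finitely many sets of measure
`δ` has small loss. -/
theorem exists_hitting_sets_for_loss {β κ : Type*} [MeasurableSpace β] [Fintype κ]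
    (D : Measure β) [IsProbabilityMeasure D] {k : ℕ} [NeZero k] {cls : β → κ} {key : β → ℝ}
    (hkey : Measurable key) (f : β → Fin k → ℝ)
    (hmeas : ∀ c i, MeasurableSet {x | cls x = c ∧ argmaxLabel (f x) = i})
    {δ : ENNReal} (h0 : 0 < δ) (h1 : δ ≤ 1) :
    ∃ G : κ × Fin k × Bool → Set β, (∀ b, MeasurableSet (G b)) ∧ (∀ b, δ ≤ D (G b)) ∧
      ∀ (P : Set β) (h : β → Fin k → ℝ), (∀ b, ∃ s ∈ P, s ∈ G b) →
        MonotoneComparisons cls key h → (∀ s ∈ P, argmaxLabel (h s) = argmaxLabel (f s)) →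
        D {x | argmaxLabel (h x) ≠ argmaxLabel (f x)} ≤
          Fintype.card (κ × Fin k × Bool) * δ := by
  have hex := fun b : κ × Fin k × Bool => exists_hitting_set D (hmeas b.1 b.2.1)
    (key := fun x => if b.2.2 then key x else -key x)
    (by split_ifs; exacts [hkey, hkey.neg]) h0 h1
  choose G hGm hGδ hG using hex
  refine ⟨G, hGm, hGδ, fun P h hP hh hPh => ?_⟩
  calc _ ≤ D (⋃ b : κ × Fin k × Bool, {x | (cls x = b.1 ∧ argmaxLabel (f x) = b.2.1) ∧
        ∀ s ∈ P, (cls s = b.1 ∧ argmaxLabel (f s) = b.2.1) →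
          (if b.2.2 then key x else -key x) < if b.2.2 then key s else -key s}) := by
        -- A point in none of these sets lies between two sample points of its own cell. There `h`
        -- has the target label of the cell, hence also at the point itself.
        refine measure_mono fun x hx => ?_
        by_contra hout
        simp only [Set.mem_iUnion, Set.mem_ofPred_eq, not_exists, not_and, not_forall,
          not_lt] at hout
        obtain ⟨s, hs, ⟨cs, fs⟩, ks⟩ := hout (cls x, argmaxLabel (f x), true) ⟨rfl, rfl⟩
        obtain ⟨t, ht, ⟨ct, ft⟩, kt⟩ := hout (cls x, argmaxLabel (f x), false) ⟨rfl, rfl⟩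
        simp only [if_true, Bool.false_eq_true, if_false, neg_le_neg_iff] at ks kt cs ct fs ft
        refine hx ?_
        rw [hh.argmaxLabel_between cs.symm (ct.trans cs.symm) ks kt
          (by rw [hPh s hs, hPh t ht, fs, ft]), hPh s hs, fs]
    _ ≤ ∑ _b : κ × Fin k × Bool, δ :=
        (measure_iUnion_fintype_le _ _).trans (Finset.sum_le_sum fun b _ => hG b P (hP b))
    _ = _ := by simp

/-- Bernoulli's inequality for `(1 + δ) ^ n`. This decay is weaker than exponential, but the sample
size enters the query bound only through its logarithm. -/
theorem pow_one_sub_le {δ : ℝ} (h0 : 0 < δ) (h1 : δ ≤ 1) {n : ℕ} (hn : 0 < n) :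
    (1 - δ) ^ n ≤ 1 / (n * δ) := by
  have hn' : (0 : ℝ) < n := by exact_mod_cast hn
  rw [le_div_iff₀ (by positivity)]
  calc (1 - δ) ^ n * (n * δ) ≤ (1 - δ) ^ n * (1 + δ) ^ n := by
        have := one_add_mul_le_pow (show (-2 : ℝ) ≤ δ by linarith) n
        have h2 : 0 ≤ (1 - δ) ^ n := pow_nonneg (by linarith) n
        exact mul_le_mul_of_nonneg_left (by linarith) h2
    _ = (1 - δ ^ 2) ^ n := by rw [← mul_pow]; ring_nf
    _ ≤ 1 := pow_le_one₀ (by nlinarith) (by nlinarith)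

theorem measure_sample_misses_le {β Ω : Type*} [MeasurableSpace β] [MeasurableSpace Ω]
    (D : Measure β) [IsProbabilityMeasure D] (ρ : Measure Ω) [IsProbabilityMeasure ρ]
    {G : Set β} (hG : MeasurableSet G) {δ : ℝ} (h0 : 0 < δ) (h1 : δ ≤ 1)
    (hδ : ENNReal.ofReal δ ≤ D G) {n m : ℕ} (hn : 0 < n) (hnm : n ≤ m) :
    ((Measure.pi fun _ : Fin m => D).prod ρ) {p | ∀ i : Fin m, (i : ℕ) < n → p.1 i ∉ G} ≤
      ENNReal.ofReal (1 / (n * δ)) := by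
  have hset : {p : (Fin m → β) × Ω | ∀ i : Fin m, (i : ℕ) < n → p.1 i ∉ G} =
      (Set.univ.pi fun i : Fin m => if (i : ℕ) < n then Gᶜ else Set.univ) ×ˢ Set.univ := by
    ext p
    simp only [Set.mem_ofPred_eq, Set.mem_prod, Set.mem_pi, Set.mem_univ, forall_true_left,
      and_true]
    refine forall_congr' fun i => ?_
    split_ifs with h <;> simp [h]
  have hcard : (Finset.univ.filter fun i : Fin m => (i : ℕ) < n).card = n := by
    have : (Finset.univ.filter fun i : Fin m => (i : ℕ) < n) =
        Finset.univ.map (Fin.castLEEmb hnm) := by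
      ext i
      simp only [Finset.mem_filter, Finset.mem_univ, true_and, Finset.mem_map]
      exact ⟨fun h => ⟨⟨i, h⟩, rfl⟩, by rintro ⟨j, rfl⟩; exact j.2⟩
    rw [this, Finset.card_map, Finset.card_univ, Fintype.card_fin]
  rw [hset, Measure.prod_prod, Measure.pi_pi, measure_univ, mul_one]
  have hGc : D Gᶜ ≤ ENNReal.ofReal (1 - δ) := by
    rw [prob_compl_eq_one_sub hG, ENNReal.ofReal_sub _ h0.le, ENNReal.ofReal_one]
    exact tsub_le_tsub_left hδ _
  calc _ = ∏ i : Fin m, if (i : ℕ) < n then D Gᶜ else 1 := by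
        refine Finset.prod_congr rfl fun i _ => ?_
        split_ifs <;> simp
    _ = (D Gᶜ) ^ n := by
        rw [← Finset.prod_filter, Finset.prod_const, hcard]
    _ ≤ (ENNReal.ofReal (1 - δ)) ^ n := by gcongr
    _ = ENNReal.ofReal ((1 - δ) ^ n) := (ENNReal.ofReal_pow (by linarith) n).symm
    _ ≤ _ := ENNReal.ofReal_le_ofReal (pow_one_sub_le h0 h1 hn)

/-! ### Linear score functions in the plane -/

/-- The signs of the two coordinates. -/
noncomputable def signClass (x : Fin 2 → ℝ) : SignType × SignType :=
  (SignType.sign (x 1), SignType.sign (x 0))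

/-- The inverse slope of a point of the plane. -/
noncomputable def invSlope (x : Fin 2 → ℝ) : ℝ := x 0 / x 1

theorem measurable_invSlope : Measurable invSlope :=
  (measurable_pi_apply 0).div (measurable_pi_apply 1)

/-- Off the axis `x 1 = 0` the form is `x 1 * (a * invSlope x + b)`, an affine function of the key
times a factor of constant sign. On the axis the key has the junk value `0`, but there the sign of
`x 0` decides everything; this is why it belongs to the class. -/
theorem linear_sign_monotone (c : SignType × SignType) (a b : ℝ) :
    (∀ x y, signClass x = c → signClass y = c → invSlope x ≤ invSlope y →
      0 < a * x 0 + b * x 1 → 0 < a * y 0 + b * y 1) ∨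
    ∀ x y, signClass x = c → signClass y = c → invSlope x ≤ invSlope y →
      0 < a * y 0 + b * y 1 → 0 < a * x 0 + b * x 1 := by
  have hsplit : ∀ x : Fin 2 → ℝ, x 1 ≠ 0 →
      a * x 0 + b * x 1 = x 1 * (a * invSlope x + b) := fun x hx => by
    rw [invSlope]; field_simp
  obtain ⟨c1, c0⟩ := c
  simp only [signClass, Prod.mk.injEq]
  rcases c1 with _ | _ | _
  · left
    rintro x y ⟨hx1, hx0⟩ ⟨hy1, hy0⟩ - h
    have hx1 : x 1 = 0 := sign_eq_zero_iff.1 hx1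
    have hy1 : y 1 = 0 := sign_eq_zero_iff.1 hy1
    rw [hx1, mul_zero, add_zero] at h
    rw [hy1, mul_zero, add_zero]
    have hs : SignType.sign (a * y 0) = SignType.sign (a * x 0) := by
      rw [sign_mul, sign_mul, hx0, hy0]
    rw [sign_pos h] at hs
    exact sign_eq_one_iff.1 hs
  · have hneg : ∀ x : Fin 2 → ℝ, SignType.sign (x 1) = SignType.neg →
        (0 < a * x 0 + b * x 1 ↔ a * invSlope x + b < 0) := by
      intro x hx
      have hx : x 1 < 0 := sign_eq_neg_one_iff.1 hx
      rw [hsplit x hx.ne]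
      constructor <;> intro h <;> nlinarith
    rcases le_total 0 a with ha | ha
    · right
      rintro x y ⟨hx, -⟩ ⟨hy, -⟩ hxy h
      rw [hneg y hy] at h
      rw [hneg x hx]
      nlinarith
    · left
      rintro x y ⟨hx, -⟩ ⟨hy, -⟩ hxy h
      rw [hneg x hx] at h
      rw [hneg y hy]
      nlinarith
  · have hpos : ∀ x : Fin 2 → ℝ, SignType.sign (x 1) = SignType.pos →
        (0 < a * x 0 + b * x 1 ↔ 0 < a * invSlope x + b) := by
      intro x hx
      have hx : 0 < x 1 := sign_eq_one_iff.1 hx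
      rw [hsplit x hx.ne']
      exact mul_pos_iff_of_pos_left hx
    rcases le_total 0 a with ha | ha
    · left
      rintro x y ⟨hx, -⟩ ⟨hy, -⟩ hxy h
      rw [hpos x hx] at h
      rw [hpos y hy]
      nlinarith
    · right
      rintro x y ⟨hx, -⟩ ⟨hy, -⟩ hxy h
      rw [hpos y hy] at h
      rw [hpos x hx]
      nlinarith

theorem monotoneComparisons_of_mem_linearClass {k : ℕ} {f : (Fin 2 → ℝ) → Fin k → ℝ}
    (hf : f ∈ linearClass 2 k) : MonotoneComparisons signClass invSlope f := by
  obtain ⟨W, rfl⟩ := hf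
  intro c i j
  have h := linear_sign_monotone c (W j 0 - W i 0) (W j 1 - W i 1)
  have heq : ∀ x : Fin 2 → ℝ, W.mulVec x i < W.mulVec x j ↔
      0 < (W j 0 - W i 0) * x 0 + (W j 1 - W i 1) * x 1 := by
    intro x
    simp only [Matrix.mulVec, dotProduct, Fin.sum_univ_two]
    constructor <;> intro h <;> linarith
  simpa only [heq] using h

theorem measurableSet_class_argmaxLabel {k : ℕ} [NeZero k] {f : (Fin 2 → ℝ) → Fin k → ℝ}
    (hf : f ∈ linearClass 2 k) (c : SignType × SignType) (i : Fin k) :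
    MeasurableSet {x | signClass x = c ∧ argmaxLabel (f x) = i} := by
  obtain ⟨W, rfl⟩ := hf
  have hW : ∀ i, Measurable fun x : Fin 2 → ℝ => W.mulVec x i := fun i => by
    simp only [Matrix.mulVec, dotProduct, Fin.sum_univ_two]
    fun_prop
  have hsign : ∀ (l : Fin 2) (c : SignType),
      MeasurableSet {x : Fin 2 → ℝ | SignType.sign (x l) = c} := by
    intro l c
    have hl : Measurable fun x : Fin 2 → ℝ => x l := measurable_pi_apply l
    have h0 : Measurable fun _ : Fin 2 → ℝ => (0 : ℝ) := measurable_const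
    rcases c with _ | _ | _
    · convert measurableSet_eq_fun hl h0 using 3
      exact sign_eq_zero_iff
    · convert measurableSet_lt hl h0 using 3
      exact sign_eq_neg_one_iff
    · convert measurableSet_lt h0 hl using 3
      exact sign_eq_one_iff
  have hlabel : MeasurableSet {x | argmaxLabel (W.mulVec x) = i} := by
    have hset : {x | argmaxLabel (W.mulVec x) = i} =
        (⋂ j, {x | W.mulVec x j ≤ W.mulVec x i}) ∩
          ⋂ j, ⋂ (_ : j < i), {x | W.mulVec x j < W.mulVec x i} := by
      ext x
      simp [argmaxLabel_eq_iff]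
    rw [hset]
    exact (MeasurableSet.iInter fun j => measurableSet_le (hW j) (hW i)).inter
      (MeasurableSet.iInter fun j => MeasurableSet.iInter fun _ =>
        measurableSet_lt (hW j) (hW i))
  simp only [signClass, Prod.ext_iff]
  exact ((hsign 1 c.1).inter (hsign 0 c.2)).inter hlabel

/-! ### The label-comparison learner -/

/-- The first `n` points of the pool, sorted by their inverse slope. -/
noncomputable def sortedPool {m : ℕ} (n : ℕ) (S : Fin m → Fin 2 → ℝ) : List (Fin m) :=
  (Finset.univ.filter fun i : Fin m => (i : ℕ) < n).toList.insertionSort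
    fun i j => invSlope (S i) ≤ invSlope (S j)

theorem mem_sortedPool {m n : ℕ} (S : Fin m → Fin 2 → ℝ) (i : Fin m) :
    i ∈ sortedPool n S ↔ (i : ℕ) < n := by
  simp [sortedPool, List.mem_insertionSort]

theorem length_sortedPool_le {m n : ℕ} (S : Fin m → Fin 2 → ℝ) :
    (sortedPool n S).length ≤ n := by
  rw [sortedPool, List.length_insertionSort, Finset.length_toList]
  calc _ = ((Finset.univ.filter fun i : Fin m => (i : ℕ) < n).map Fin.valEmbedding).card :=
        (Finset.card_map _).symm
    _ ≤ (Finset.range n).card := Finset.card_le_card fun i hi => by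
        obtain ⟨j, hj, rfl⟩ := Finset.mem_map.1 hi
        simpa using hj
    _ = n := Finset.card_range n

theorem pairwise_sortedPool {m n : ℕ} (S : Fin m → Fin 2 → ℝ) :
    (sortedPool n S).Pairwise fun i j => invSlope (S i) ≤ invSlope (S j) := by
  have : Std.Total fun i j : Fin m => invSlope (S i) ≤ invSlope (S j) :=
    ⟨fun i j => le_total _ _⟩
  have : IsTrans (Fin m) fun i j => invSlope (S i) ≤ invSlope (S j) :=
    ⟨fun _ _ _ => le_trans⟩
  exact List.pairwise_insertionSort _ _

open Classical in
/-- A linear score function with the labels `g` at the points `S i`, `i < n`, if there is one. -/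
noncomputable def consistentHypothesis {k m : ℕ} [NeZero k] (n : ℕ) (S : Fin m → Fin 2 → ℝ)
    (g : Fin m → Fin k) : (Fin 2 → ℝ) → Fin k → ℝ :=
  if h : ∃ f ∈ linearClass 2 k, ∀ i : Fin m, (i : ℕ) < n → argmaxLabel (f (S i)) = g i then
    h.choose
  else 0

/-- The target itself is consistent, so the default `0` is not used. Linearity of the output is
essential: generalization needs its comparisons to be monotone. -/
theorem consistentHypothesis_spec {k m : ℕ} [NeZero k] {n : ℕ} {S : Fin m → Fin 2 → ℝ}
    {g : Fin m → Fin k} {f : (Fin 2 → ℝ) → Fin k → ℝ} (hf : f ∈ linearClass 2 k)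
    (hfg : ∀ i : Fin m, (i : ℕ) < n → argmaxLabel (f (S i)) = g i) :
    consistentHypothesis n S g ∈ linearClass 2 k ∧
      ∀ i : Fin m, (i : ℕ) < n → argmaxLabel (consistentHypothesis n S g (S i)) = g i := by
  have h : ∃ f ∈ linearClass 2 k, ∀ i : Fin m, (i : ℕ) < n → argmaxLabel (f (S i)) = g i :=
    ⟨f, hf, hfg⟩
  rw [consistentHypothesis, dif_pos h]
  exact h.choose_spec

/-- Label the first `n` pool points by divide and conquer over the labels, and return a
consistent linear score function. -/
noncomputable def envelopeTree (k m : ℕ) [NeZero k] (n : ℕ) (S : Fin m → Fin 2 → ℝ) :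
    QueryTree (Fin m × Fin k × Fin k) Bool ((Fin 2 → ℝ) → Fin k → ℝ) :=
  (envelope (fun i => signClass (S i)) (sortedPool n S) (Nat.clog 2 n) (Nat.clog 2 k) 0).bind
    fun g => QueryTree.output (consistentHypothesis n S g)

/-- The number of pool points that the learner uses. -/
noncomputable def sampleSize (ε : ℝ) (k : ℕ) : ℕ := ⌈2592 * (k : ℝ) ^ 2 / ε⌉₊

/-- The learner that runs `envelopeTree` on `sampleSize ε k` pool points. -/
noncomputable def envelopeLearner : ActiveLearner 2 (comparisonSupervision 2) Unit :=
  fun ε k m _ S _ => envelopeTree k m (sampleSize ε k) S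

theorem cost_envelopeTree_le {k m n : ℕ} [NeZero k] {f : (Fin 2 → ℝ) → Fin k → ℝ}
    (hf : f ∈ linearClass 2 k) (S : Fin m → Fin 2 → ℝ) :
    (envelopeTree k m n S).cost (fun p => compareScores (f (S p.1)) p.2) ≤
      Nat.clog 2 k * 2 ^ Nat.clog 2 k * (9 * (Nat.clog 2 n + 1)) := by
  rw [envelopeTree, QueryTree.cost_bind]
  exact cost_envelope_le (fun i => signClass (S i)) (fun i => invSlope (S i)) (fun i => f (S i))
    ((monotoneComparisons_of_mem_linearClass hf).comp S) _ (pairwise_sortedPool S) _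
    ((length_sortedPool_le S).trans (Nat.le_pow_clog one_lt_two n)) _ _

theorem run_envelopeTree {k m n : ℕ} [NeZero k] {f : (Fin 2 → ℝ) → Fin k → ℝ}
    (hf : f ∈ linearClass 2 k) (S : Fin m → Fin 2 → ℝ) :
    (envelopeTree k m n S).run (fun p => compareScores (f (S p.1)) p.2) ∈ linearClass 2 k ∧
      ∀ i : Fin m, (i : ℕ) < n → argmaxLabel
        ((envelopeTree k m n S).run (fun p => compareScores (f (S p.1)) p.2) (S i)) =
          argmaxLabel (f (S i)) := by
  have hg : ∀ i : Fin m, (i : ℕ) < n →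
      argmaxLabel (f (S i)) = (envelope (fun i => signClass (S i)) (sortedPool n S)
        (Nat.clog 2 n) (Nat.clog 2 k) 0).run (fun p => compareScores (f (S p.1)) p.2) i := by
    intro i hi
    rw [run_envelope (fun i => signClass (S i)) (fun i => invSlope (S i)) (fun i => f (S i))
      ((monotoneComparisons_of_mem_linearClass hf).comp S) _ (pairwise_sortedPool S) _
      ((length_sortedPool_le S).trans (Nat.le_pow_clog one_lt_two n)) _ _ i
      ((mem_sortedPool S i).2 hi),
      blockWinner_eq_argmaxLabel _ _ (Nat.le_pow_clog one_lt_two k)]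
  rw [envelopeTree, QueryTree.run_bind]
  obtain ⟨h1, h2⟩ := consistentHypothesis_spec hf hg
  exact ⟨h1, fun i hi => (h2 i hi).trans (hg i hi).symm⟩

theorem envelopeTree_success (D : Measure (Fin 2 → ℝ)) [IsProbabilityMeasure D] {k : ℕ}
    [NeZero k] {f : (Fin 2 → ℝ) → Fin k → ℝ} (hf : f ∈ linearClass 2 k) {ε : ℝ} (hε : 0 < ε)
    (hε1 : ε < 1) {m : ℕ} (hm : sampleSize ε k ≤ m) {Ω : Type*} [MeasurableSpace Ω]
    (ρ : Measure Ω) [IsProbabilityMeasure ρ] :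
    ((Measure.pi fun _ : Fin m => D).prod ρ)
      {p | ENNReal.ofReal ε < zeroOneLoss D f ((envelopeTree k m (sampleSize ε k) p.1).run
        fun q => compareScores (f (p.1 q.1)) q.2)} ≤ 1 / 8 := by
  have hk1 : (1 : ℝ) ≤ k := by exact_mod_cast NeZero.pos k
  have hcard : Fintype.card ((SignType × SignType) × Fin k × Bool) = 18 * k := by
    rw [Fintype.card_prod, Fintype.card_prod, Fintype.card_prod, Fintype.card_fin,
      Fintype.card_bool, show Fintype.card SignType = 3 from rfl]
    ring
  -- There are 9 sign classes, `k` labels and 2 ends of each cell.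
  set δ : ℝ := ε / (18 * k) with hδ
  have hδ0 : 0 < δ := by positivity
  have hδ1 : δ ≤ 1 := by rw [hδ, div_le_one (by positivity)]; linarith
  set n := sampleSize ε k with hn
  have hnle : 2592 * (k : ℝ) ^ 2 / ε ≤ n := Nat.le_ceil _
  have hn0 : 0 < n := by
    have : (0 : ℝ) < n := lt_of_lt_of_le (by positivity) hnle
    exact_mod_cast this
  obtain ⟨G, hGm, hGδ, hG⟩ := exists_hitting_sets_for_loss D measurable_invSlope f
    (measurableSet_class_argmaxLabel hf) (ENNReal.ofReal_pos.2 hδ0)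
    (ENNReal.ofReal_le_one.2 hδ1)
  calc _ ≤ ((Measure.pi fun _ : Fin m => D).prod ρ)
        (⋃ b, {p | ∀ i : Fin m, (i : ℕ) < n → p.1 i ∉ G b}) := by
        refine measure_mono fun p hp => ?_
        by_contra hout
        simp only [Set.mem_iUnion, Set.mem_ofPred_eq, not_exists, not_forall, not_not] at hout
        refine not_le.2 (show ENNReal.ofReal ε < _ from hp) ?_
        obtain ⟨h1, h2⟩ := run_envelopeTree (n := n) hf p.1
        refine (hG {x | ∃ i : Fin m, (i : ℕ) < n ∧ p.1 i = x} _ (fun b => ?_)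
          (monotoneComparisons_of_mem_linearClass h1) ?_).trans_eq ?_
        · obtain ⟨i, hi, hiG⟩ := hout b
          exact ⟨_, ⟨i, hi, rfl⟩, hiG⟩
        · rintro _ ⟨i, hi, rfl⟩
          exact h2 i hi
        · rw [hcard, ← ENNReal.ofReal_natCast, ← ENNReal.ofReal_mul (by positivity), hδ]
          push_cast
          congr 1
          field_simp
    _ ≤ ∑ _b : (SignType × SignType) × Fin k × Bool, ENNReal.ofReal (1 / (n * δ)) :=
        (measure_iUnion_fintype_le _ _).trans (Finset.sum_le_sum fun b _ =>
          measure_sample_misses_le D ρ (hGm b) hδ0 hδ1 (hGδ b) hn0 hm)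
    _ = ENNReal.ofReal (18 * k * (1 / (n * δ))) := by
        rw [Finset.sum_const, Finset.card_univ, hcard, nsmul_eq_mul, ← ENNReal.ofReal_natCast,
          ← ENNReal.ofReal_mul (by positivity)]
        push_cast
        rfl
    _ ≤ ENNReal.ofReal (1 / 8) := by
        -- The union bound is `(18 k)² / (n ε)`, and `2592 = 8 * 18²`.
        refine ENNReal.ofReal_le_ofReal ?_
        have hn' : (0 : ℝ) < n := by exact_mod_cast hn0
        rw [div_le_iff₀ hε] at hnle
        rw [hδ, mul_one_div, div_le_div_iff₀ (by positivity) (by norm_num)]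
        have : 18 * (k : ℝ) * 8 * (18 * k) ≤ n * ε := by nlinarith
        calc 18 * (k : ℝ) * 8 = 18 * (k : ℝ) * 8 * (18 * k) / (18 * k) := by field_simp
          _ ≤ n * ε / (18 * k) := by gcongr
          _ = _ := by ring
    _ = 1 / 8 := by
        rw [ENNReal.ofReal_div_of_pos (by norm_num)]
        simp

theorem envelopeLearner_learns (X : Set (Fin 2 → ℝ)) :
    LearnsWithQueries X (linearClass 2) (comparisonSupervision 2) (Measure.dirac ())
      envelopeLearner fun ε k =>
        Nat.clog 2 k * 2 ^ Nat.clog 2 k * (9 * (Nat.clog 2 (sampleSize ε k) + 1)) :=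
  ⟨sampleSize, fun D _ _ _ _ _ hf _ hε hε1 _ hm =>
    ⟨fun S _ _ => cost_envelopeTree_le hf S, envelopeTree_success D hf hε hε1 hm _⟩⟩

/-! ### Size of the query bound -/

theorem clog_two_mul_log_two_le {n : ℕ} (hn : 2 ≤ n) :
    Nat.clog 2 n * Real.log 2 ≤ Real.log (2 * n) ∧ 2 ^ Nat.clog 2 n ≤ 2 * n := by
  have h := Nat.pow_pred_clog_lt_self one_lt_two hn
  have hpos := Nat.clog_pos one_lt_two hn
  have h2 : 2 ^ Nat.clog 2 n ≤ 2 * n := by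
    calc 2 ^ Nat.clog 2 n = 2 * 2 ^ (Nat.clog 2 n).pred := by
          rw [← pow_succ', ← Nat.succ_eq_add_one, Nat.succ_pred_eq_of_pos hpos]
      _ ≤ _ := by omega
  refine ⟨?_, h2⟩
  rw [← Real.log_pow]
  exact Real.log_le_log (by positivity) (by exact_mod_cast h2)

theorem envelope_cost_bound {k : ℕ} {ε : ℝ} (hk : 2 ≤ k) (hε : 0 < ε) (hε2 : ε ≤ 1 / 2) :
    ((Nat.clog 2 k * 2 ^ Nat.clog 2 k * (9 * (Nat.clog 2 (sampleSize ε k) + 1)) : ℕ) : ℝ) ≤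
      612 / Real.log 2 ^ 3 * (k * Real.log (1 / ε)) * Real.log k ^ 2 := by
  have hk2 : (2 : ℝ) ≤ k := by exact_mod_cast hk
  set l := Real.log 2 with hl
  have hl0 : 0 < l := Real.log_pos (by norm_num)
  set K := Real.log k with hK
  have hlK : l ≤ K := Real.log_le_log (by norm_num) hk2
  set L := Real.log (1 / ε) with hL
  have hlL : l ≤ L := Real.log_le_log (by norm_num) (by rw [le_div_iff₀ hε]; linarith)
  obtain ⟨hd, hd2⟩ := clog_two_mul_log_two_le hk
  have hn2 : 2 ≤ sampleSize ε k := by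
    have : (2 : ℝ) ≤ sampleSize ε k := by
      refine le_trans ?_ (Nat.le_ceil _)
      rw [le_div_iff₀ hε]
      nlinarith
    exact_mod_cast this
  obtain ⟨he, -⟩ := clog_two_mul_log_two_le hn2
  rw [Real.log_mul (by norm_num) (by positivity)] at hd
  have hn : (2 * sampleSize ε k : ℝ) ≤ 2 ^ 13 * k ^ 2 * (1 / ε) := by
    have h1 : (sampleSize ε k : ℝ) < 2592 * (k : ℝ) ^ 2 / ε + 1 :=
      Nat.ceil_lt_add_one (by positivity)
    have h2 : 1 ≤ (k : ℝ) ^ 2 / ε := by rw [le_div_iff₀ hε]; nlinarith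
    have h3 : 2592 * (k : ℝ) ^ 2 / ε = 2592 * (k ^ 2 / ε) := by ring
    have h4 : (2 : ℝ) ^ 13 * k ^ 2 * (1 / ε) = 2 ^ 13 * (k ^ 2 / ε) := by ring
    rw [h3] at h1
    rw [h4]
    linarith
  have hlog : Real.log (2 * sampleSize ε k) ≤ 13 * l + 2 * K + L := by
    refine (Real.log_le_log (by positivity) hn).trans_eq ?_
    rw [Real.log_mul (by positivity) (by positivity), Real.log_mul (by positivity)
      (by positivity), Real.log_pow, Real.log_pow]
    push_cast
    rfl
  have hd' : (Nat.clog 2 k : ℝ) ≤ 2 * K / l := by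
    rw [le_div_iff₀ hl0]; linarith
  -- Since `l ≤ K` and `l ≤ L`, each of `l²`, `K l`, `L l` is at most `K L`, and `17 = 14 + 2 + 1`.
  -- The final constant is `612 = 2 * 2 * 9 * 17`.
  have he' : (Nat.clog 2 (sampleSize ε k) : ℝ) + 1 ≤ 17 * (K * L) / l ^ 2 := by
    rw [le_div_iff₀ (by positivity)]
    have h1 : ((Nat.clog 2 (sampleSize ε k) : ℝ) + 1) * l ≤ 14 * l + 2 * K + L := by linarith
    have h2 := mul_le_mul_of_nonneg_right h1 hl0.le
    nlinarith [mul_le_mul hlK hlL hl0.le (hl0.le.trans hlK)]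
  have hd2' : (2 : ℝ) ^ Nat.clog 2 k ≤ 2 * k := by exact_mod_cast hd2
  push_cast
  have hK0 : 0 < K := hl0.trans_le hlK
  have hL0 : 0 < L := hl0.trans_le hlL
  calc _ ≤ 2 * K / l * (2 * k) * (9 * (17 * (K * L) / l ^ 2)) := by gcongr
    _ = _ := by field_simp; ring

theorem mainTheorem1 :
    -- label comparisons: `Õ(k log(1/ε))`, with a deterministic learner
    (∃ (C : ℝ) (a : ℕ), 0 < C ∧
      ∀ X : Set (Fin 2 → ℝ), {x : Fin 2 → ℝ | x 1 = 1} ⊆ X →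
        ∃ (A : ActiveLearner 2 (comparisonSupervision 2) Unit) (q : ℝ → ℕ → ℕ),
          LearnsWithQueries X (linearClass 2) (comparisonSupervision 2) (Measure.dirac ()) A q ∧
          ∀ (k : ℕ) (ε : ℝ), 2 ≤ k → 0 < ε → ε ≤ 1 / 2 →
            (q ε k : ℝ) ≤ C * (k * Real.log (1 / ε)) * Real.log k ^ a) ∧
    -- simulating any argmax learner by tournaments: `Ω̃(k² log(1/ε))` comparisons
    (∃ (c : ℝ) (a : ℕ), 0 < c ∧
      ∀ X : Set (Fin 2 → ℝ), {x : Fin 2 → ℝ | x 1 = 1} ⊆ X →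
        ∀ (Ω : Type) [MeasurableSpace Ω] (ρ : Measure Ω) [IsProbabilityMeasure ρ]
          (A : ActiveLearner 2 (argmaxSupervision 2) Ω) (qArg : ℝ → ℕ → ℕ),
          LearnsWithQueries X (linearClass 2) (argmaxSupervision 2) ρ A qArg →
          ∀ T : ∀ (k : ℕ) [NeZero k], QueryTree (Fin k × Fin k) Bool (Fin k),
            (∀ (k : ℕ) [NeZero k], IsTournament (T k)) →
            ∀ q : ℝ → ℕ → ℕ,
              LearnsWithQueries X (linearClass 2) (comparisonSupervision 2) ρ
                (simulateByTournaments A T) q →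
              ∀ (k : ℕ) (ε : ℝ), 2 ≤ k → 0 < ε → ε ≤ 1 / 2 →
                c * ((k : ℝ) ^ 2 * Real.log (1 / ε)) / Real.log k ^ a ≤ (q ε k : ℝ)) := by
  refine ⟨⟨612 / Real.log 2 ^ 3, 2, by have := Real.log_pos one_lt_two; positivity,
    fun X _ => ⟨envelopeLearner, _, envelopeLearner_learns X,
      fun k ε hk hε hε2 => envelope_cost_bound hk hε hε2⟩⟩,
    Real.log 2 / 512, 2, by have := Real.log_pos one_lt_two; positivity, ?_⟩
  intro X hX Ω _ ρ _ A qArg hA T hT q hq k ε hk hε hε2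
  exact simulated_argmax_lower_bound hX hA hT hq hk hε hε2
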